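/- Let $x=(x_1,x_2,\ldots)$ and $y=(y_1,y_2,\ldots)$ be two sequences of countably many indeterminates. For a partition $\lambda$ let $s_\lambda(x)$ be the universal Schur function, i.e. the formal power series with $s_\lambda(x_1,\ldots,x_n,0,0,\ldots)=\det(x_i^{\lambda_j+n-j})_{i,j=1}^n/\det(x_i^{n-j})_{i,j=1}^n$ for all $n\ge\ell(\lambda)$, and let $\Lambda$ be the ring of symmetric functions over $\mathbb Z$, generated by all $s_\lambda$ (they form a $\mathbb Z$-basis of $\Lambda$). Let $c_{\lambda\mu}^\nu\in\mathbb Z$ be the Littlewood–Richardson coefficients, $s_\lambda s_\mu=\sum_\nu c_{\lambda\mu}^\nu s_\nu$, and let $s_{\nu/\lambda}=\sum_\mu c_{\lambda\mu}^\nu s_\mu$ be the skew Schur functions. The universal characters $[\lambda]$ of the orthogonal groups and $\langle\lambda\rangle$ of the symplectic groups are the elements of $\Lambda$, indexed by partitions $\lambda$, that are defined by the generating functions $$\prod_{i,a}(1-x_iy_a)^{-1}\prod_{a\le b}(1-y_ay_b)=\sum_\lambda[\lambda](x)\,s_\lambda(y),\qquad \prod_{i,a}(1-x_iy_a)^{-1}\prod_{a<b}(1-y_ay_b)=\sum_\lambda\langle\lambda\rangle(x)\,s_\lambda(y);$$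 each of these identities determines a unique family of elements of $\Lambda$. For $X=\sum_\nu a_\nu s_\nu\in\Lambda$ put $[X]=\sum_\nu a_\nu[\nu]$ and $\langle X\rangle=\sum_\nu a_\nu\langle\nu\rangle$. Theorem. For all partitions $\lambda,\mu$, $$[\lambda]\cdot[\mu]=\sum_\sigma\,[\,s_{\lambda/\sigma}\cdot s_{\mu/\sigma}\,]\qquad\text{and}\qquad \langle\lambda\rangle\cdot\langle\mu\rangle=\sum_\sigma\,\langle\, s_{\lambda/\sigma}\cdot s_{\mu/\sigma}\,\rangle ,$$ where the products are taken in $\Lambda$, $\sigma$ runs over all partitions, and only finitely many terms of each sum are nonzero. -/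

import Mathlib

open scoped MvPowerSeries.WithPiTopology

/-! Partitions are Young diagrams: `lam.rowLen j` is the part `λ_{j+1}` and `lam.colLen 0` is the
length `ℓ(λ)`. The indeterminates `x_1, x_2, …` are indexed by `ℕ`. -/

/-- The alternant `a_{λ+ρ}(x_1, …, x_n) = det (x_i ^ (λ_j + n - j))`; for the empty partition it is
the Vandermonde determinant `a_ρ(x_1, …, x_n)`. -/
noncomputable def alternant (n : ℕ) (lam : YoungDiagram) : MvPolynomial ℕ ℤ :=
  Matrix.det (Matrix.of fun i j : Fin n =>
    (MvPolynomial.X (i : ℕ) : MvPolynomial ℕ ℤ) ^ (lam.rowLen j + (n - 1 - j)))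

theorem sub_dvd_alternant (n : ℕ) (lam : YoungDiagram) (i j : Fin n) (hij : i ≠ j) :
    (MvPolynomial.X (j : ℕ) - MvPolynomial.X (i : ℕ) : MvPolynomial ℕ ℤ) ∣ alternant n lam := by
  have h : ∀ k : ℕ, (MvPolynomial.X (j : ℕ) - MvPolynomial.X (i : ℕ) : MvPolynomial ℕ ℤ) ∣
      MvPolynomial.X (j : ℕ) ^ k - MvPolynomial.X (i : ℕ) ^ k := fun k => sub_dvd_pow_sub_pow _ _ k
  choose q hq using h
  unfold alternant
  set M := Matrix.of fun i j : Fin n =>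
    (MvPolynomial.X (i : ℕ) : MvPolynomial ℕ ℤ) ^ (lam.rowLen j + (n - 1 - j)) with hM
  rw [← Matrix.det_updateRow_add_smul_self M hij.symm (-1)]
  have : M j + (-1 : MvPolynomial ℕ ℤ) • M i =
      (MvPolynomial.X (j : ℕ) - MvPolynomial.X (i : ℕ) : MvPolynomial ℕ ℤ) •
        fun k : Fin n => q (lam.rowLen k + (n - 1 - k)) := by
    funext k
    have hk := hq (lam.rowLen k + (n - 1 - k))
    simp only [hM, Pi.add_apply, Pi.smul_apply, Matrix.of_apply, smul_eq_mul]
    rw [← hk]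
    ring
  rw [this, Matrix.det_updateRow_smul]
  exact dvd_mul_right _ _

theorem isRelPrime_X_sub_X {i j k l : ℕ} (hij : i < j) (hkl : k < l) (h : (i, j) ≠ (k, l)) :
    IsRelPrime (MvPolynomial.X j - MvPolynomial.X i : MvPolynomial ℕ ℤ)
      (MvPolynomial.X l - MvPolynomial.X k) := by
  have hirr : Irreducible (MvPolynomial.X j - MvPolynomial.X i : MvPolynomial ℕ ℤ) := by
    apply MvPolynomial.irreducible_of_totalDegree_eq_one
    · apply le_antisymm
      · exact (MvPolynomial.totalDegree_sub _ _).trans (by simp)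
      · have := MvPolynomial.le_totalDegree (p := (MvPolynomial.X j - MvPolynomial.X i : MvPolynomial ℕ ℤ))
          (s := Finsupp.single j 1) (by
            simp [MvPolynomial.mem_support_iff, MvPolynomial.coeff_X, Finsupp.single_left_inj, hij.ne])
        simpa using this
    · intro x hx
      have := hx (Finsupp.single j 1)
      simp [MvPolynomial.coeff_X, Finsupp.single_left_inj, hij.ne] at this
      exact isUnit_of_dvd_one (this) 
  rw [hirr.isRelPrime_iff_not_dvd]
  rintro ⟨q, hq⟩
  have key : ∀ f : ℕ → ℤ, f i = f j → f k = f l := by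
    intro f hf
    have := congrArg (MvPolynomial.eval f) hq
    simp [hf] at this
    linarith
  have h1 := key (fun t => if t = i ∨ t = j then 0 else if t = k then 1 else 2) (by simp)
  simp only at h1
  have h2 : ¬ (i = k ∧ j = l) := by simpa using h
  split_ifs at h1 <;> omega

theorem alternant_bot_dvd (n : ℕ) (lam : YoungDiagram) : alternant n ⊥ ∣ alternant n lam := by
  have h0 : Associated (alternant n ⊥)
      (Matrix.vandermonde fun i : Fin n => (MvPolynomial.X (i : ℕ) : MvPolynomial ℕ ℤ)).det := by
    have : (Matrix.of fun i j : Fin n =>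
        (MvPolynomial.X (i : ℕ) : MvPolynomial ℕ ℤ) ^ ((⊥ : YoungDiagram).rowLen j + (n - 1 - j)))
        = (Matrix.vandermonde fun i : Fin n => (MvPolynomial.X (i : ℕ) : MvPolynomial ℕ ℤ)).submatrix
          id (Fin.revPerm) := by
      ext1 i j
      have hb : (⊥ : YoungDiagram).rowLen j = 0 := by simp [YoungDiagram.rowLen]
      simp only [Matrix.of_apply, Matrix.submatrix_apply, Matrix.vandermonde_apply, hb, id,
        Fin.revPerm_apply, Fin.val_rev]
      congr 1
      omega
    unfold alternant
    rw [this, Matrix.det_permute']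
    rcases Int.units_eq_one_or (Equiv.Perm.sign (Fin.revPerm : Equiv.Perm (Fin n))) with h | h <;>
      simp [h]
  rw [h0.dvd_iff_dvd_left, Matrix.det_vandermonde, Finset.prod_sigma']
  apply Finset.prod_dvd_of_isRelPrime
  · rintro ⟨i, j⟩ hij ⟨k, l⟩ hkl h
    simp at hij hkl
    refine isRelPrime_X_sub_X hij hkl ?_
    intro h'
    apply h
    simp [Fin.val_inj] at h'
    simp [h']
  · rintro ⟨i, j⟩ hij
    simp at hij
    exact sub_dvd_alternant n lam i j hij.ne

/-- The Schur polynomial `s_λ(x_1, …, x_n) = a_{λ+ρ} / a_ρ`, the exact quotient of the two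
alternants (to be used for `ℓ(λ) ≤ n`). -/
noncomputable def schurPoly (n : ℕ) (lam : YoungDiagram) : MvPolynomial ℕ ℤ :=
  (alternant_bot_dvd n lam).choose

theorem alternant_eq (n : ℕ) (lam : YoungDiagram) :
    alternant n lam = alternant n ⊥ * schurPoly n lam :=
  (alternant_bot_dvd n lam).choose_spec

/-- The universal Schur function `s_λ(x_1, x_2, …)` as a power series in countably many
indeterminates, obtained from the Schur polynomials by stability: the coefficient of a monomial is
read off from `s_λ(x_1, …, x_n)` with `n` so large that `ℓ(λ) ≤ n` and that the monomial involves
only `x_1, …, x_n`. -/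
noncomputable def schurSeries (lam : YoungDiagram) : MvPowerSeries ℕ ℤ := fun m =>
  MvPolynomial.coeff m (schurPoly (max (lam.colLen 0) (m.support.sup Nat.succ)) lam)

/-- The ring `Λ` of symmetric functions: the ring generated by all universal Schur functions. -/
noncomputable def symmetricFunctions : Subalgebra ℤ (MvPowerSeries ℕ ℤ) :=
  Algebra.adjoin ℤ (Set.range schurSeries)

/-- The universal Schur function `s_λ = {λ}` as an element of `Λ`. -/
noncomputable def schur (lam : YoungDiagram) : symmetricFunctions :=
  ⟨schurSeries lam, Algebra.subset_adjoin (Set.mem_range_self lam)⟩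

/-- The coefficients `a_σ` in the expansion `X = ∑_σ a_σ s_σ` of `X ∈ Λ`: the inverse of the
bijection sending a finitely supported family `(a_σ)` to `∑_σ a_σ s_σ`. -/
noncomputable def schurCoeff (X : symmetricFunctions) : YoungDiagram →₀ ℤ :=
  Function.invFun (Finsupp.linearCombination ℤ schur) X

/-- The Littlewood–Richardson coefficient `c_{λμ}^ν`, the coefficient of `s_ν` in `s_λ s_μ`. -/
noncomputable def lrCoeff (lam mu nu : YoungDiagram) : ℤ :=
  schurCoeff (schur lam * schur mu) nu

/-- The skew Schur function `s_{ν/λ} = ∑_μ c_{λμ}^ν s_μ` (a finite sum). -/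
noncomputable def skewSchur (nu lam : YoungDiagram) : symmetricFunctions :=
  ∑ᶠ mu : YoungDiagram, lrCoeff lam mu nu • schur mu

/-- For a family `ch` of symmetric functions indexed by partitions, its linear extension to symbols
of the form `X = ∑_ν a_ν s_ν ∈ Λ`, namely `ch(X) = ∑_ν a_ν ch(ν)`. -/
noncomputable def linearExtension (ch : YoungDiagram → symmetricFunctions)
    (X : symmetricFunctions) : symmetricFunctions :=
  Finsupp.linearCombination ℤ ch (schurCoeff X)

/-! Power series in two alphabets: `x_i` is `X (Sum.inl i)` and `y_a` is `X (Sum.inr a)`. Infinite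
products and sums are taken in the topology of coefficientwise convergence. -/

/-- A symmetric function in the first alphabet, `f(x)`. -/
noncomputable def inX (f : symmetricFunctions) : MvPowerSeries (ℕ ⊕ ℕ) ℤ :=
  MvPowerSeries.rename (Function.Embedding.inl : ℕ ↪ ℕ ⊕ ℕ) (f : MvPowerSeries ℕ ℤ)

/-- A symmetric function in the second alphabet, `f(y)`. -/
noncomputable def inY (f : symmetricFunctions) : MvPowerSeries (ℕ ⊕ ℕ) ℤ :=
  MvPowerSeries.rename (Function.Embedding.inr : ℕ ↪ ℕ ⊕ ℕ) (f : MvPowerSeries ℕ ℤ)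

/-- The Cauchy kernel `∏_{i,a} (1 - x_i y_a)⁻¹`. -/
noncomputable def cauchyKernel : MvPowerSeries (ℕ ⊕ ℕ) ℤ :=
  ∏' p : ℕ × ℕ, MvPowerSeries.invOfUnit
    (1 - MvPowerSeries.X (Sum.inl p.1) * MvPowerSeries.X (Sum.inr p.2)) 1

/-- The product `∏_{a ≤ b} (1 - y_a y_b)`. -/
noncomputable def productLE : MvPowerSeries (ℕ ⊕ ℕ) ℤ :=
  ∏' p : {p : ℕ × ℕ // p.1 ≤ p.2},
    (1 - MvPowerSeries.X (Sum.inr p.1.1) * MvPowerSeries.X (Sum.inr p.1.2))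

/-- The product `∏_{a < b} (1 - y_a y_b)`. -/
noncomputable def productLT : MvPowerSeries (ℕ ⊕ ℕ) ℤ :=
  ∏' p : {p : ℕ × ℕ // p.1 < p.2},
    (1 - MvPowerSeries.X (Sum.inr p.1.1) * MvPowerSeries.X (Sum.inr p.1.2))

/-- The family `o`, `o λ = [λ]`, is the family of universal characters of the orthogonal groups:
`∏_{i,a} (1 - x_i y_a)⁻¹ ∏_{a ≤ b} (1 - y_a y_b) = ∑_λ [λ](x) {λ}(y)`. -/
def IsOrthogonalCharacters (o : YoungDiagram → symmetricFunctions) : Prop :=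
  HasSum (fun lam => inX (o lam) * inY (schur lam)) (cauchyKernel * productLE)

/-- The family `sp`, `sp λ = ⟨λ⟩`, is the family of universal characters of the symplectic groups:
`∏_{i,a} (1 - x_i y_a)⁻¹ ∏_{a < b} (1 - y_a y_b) = ∑_λ ⟨λ⟩(x) {λ}(y)`. -/
def IsSymplecticCharacters (sp : YoungDiagram → symmetricFunctions) : Prop :=
  HasSum (fun lam => inX (sp lam) * inY (schur lam)) (cauchyKernel * productLT)

/-!
Let `p(x)` be the product of the factors `1 - x_i x_j` over `i ≤ j` (orthogonal case) or over
`i < j` (symplectic case), and let `K(x, y) = ∏ (1 - x_i y_a)⁻¹`. Splitting the pairs of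
indeterminates of a combined alphabet into pairs from `x`, pairs from `y` and mixed pairs gives

  `p(x, y) K(x, y) = p(x) p(y)`  (`pairProduct_sum_mul_cauchyKernel`),

and the theorem holds for every symmetric series `p` with this property (`universalCharacter_mul`).
By the Cauchy identity `K(x, y) = ∑ s_λ(x) s_λ(y)`, the generating function `K(x, y) p(y)` defines
the family for which the coefficient of `s_θ` in `[λ]` is the coefficient of `s_λ` in `s_θ p`
(`hasSum_cauchyKernel_mul_iff_eq`, `schurFunctional_universalCharacter`). Now compare the
coefficients of `s_θ` on the two sides of the product formula.

* In `[λ] [μ]` it is the coefficient of `s_λ(x) s_μ(y)` in `s_θ(x, y) p(x) p(y)`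
  (`schurFunctional_universalCharacter_mul`).
* In `[s_κ s_τ]` it is the coefficient of `s_κ(x) s_τ(y)` in `(s_θ p)(x, y)`, and passing from
  `s_κ s_τ` to `∑_σ s_{λ/σ} s_{μ/σ}` amounts to multiplying by `K(x, y) = ∑ s_σ(x) s_σ(y)`. So in
  the sum it is the coefficient of `s_λ(x) s_μ(y)` in `s_θ(x, y) p(x, y) K(x, y)`
  (`schurFunctional_sum_linearExtension`).

Coefficients with respect to Schur functions are taken by linear functionals on all power series
(`schurFunctional`), so that infinite series such as `p` and `K` need no special treatment. These
functionals, the Cauchy identity and the expansion of `f(x, y)` in products of Schur functions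
(`biSchurFunctional_rename`) all rest on the Jacobi–Trudi identity (`schurSeries_eq_det`) and on the
symmetry of the coefficients of the complete homogeneous functions (`coeff_hsymmProd_comm`).
-/

/-! ### Jacobi–Trudi determinants -/

/-- The Jacobi–Trudi matrix of `lam` with entry `h j (λ_{j+1} - j + k)` at `(j, k)`, zero where that
index is negative. The family `h` may depend on the row: with `h j r = z_j ^ r` the determinant
records which monomials occur in the expansion. -/
def jtMatrix {R : Type*} [Zero R] (n : ℕ) (lam : YoungDiagram) (h : ℕ → ℕ → R) :
    Matrix (Fin n) (Fin n) R :=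
  Matrix.of fun j k => if (j : ℕ) ≤ lam.rowLen j + k then h j (lam.rowLen j + k - j) else 0

/-- The Jacobi–Trudi expansion with values in a group: the signed sum of `v b` over the exponent
vectors `b j = λ_{j+1} - j + w j`, a permutation `w` contributing only if all of these are
nonnegative. It is the Jacobi–Trudi determinant under the additive map `z ^ b ↦ v b`. -/
noncomputable def jtSum {A : Type*} [AddCommGroup A] (n : ℕ) (lam : YoungDiagram)
    (v : (ℕ →₀ ℕ) → A) : A :=
  ∑ w : Equiv.Perm (Fin n), (Equiv.Perm.sign w : ℤ) •
    if ∀ j : Fin n, (j : ℕ) ≤ lam.rowLen j + w j then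
      v (∑ j : Fin n, Finsupp.single (j : ℕ) (lam.rowLen j + w j - j)) else 0

theorem finsupp_prod_sum_single {R : Type*} [CommMonoid R] (n : ℕ) (r : Fin n → ℕ) (h : ℕ → ℕ → R)
    (h0 : ∀ j, h j 0 = 1) :
    (∑ j : Fin n, Finsupp.single (j : ℕ) (r j)).prod h = ∏ j : Fin n, h j (r j) := by
  have hv : ∀ i : Fin n, (∑ j : Fin n, Finsupp.single (j : ℕ) (r j)) (i : ℕ) = r i := by
    intro i
    rw [Finsupp.finsetSum_apply, Finset.sum_eq_single i]
    · simp
    · intro j _ hj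
      exact Finsupp.single_eq_of_ne (fun h' => hj (Fin.ext h'.symm))
    · simp
  rw [Finsupp.prod_of_support_subset _ (s := Finset.univ.map Fin.valEmbedding) _ _
    (fun i _ => h0 i)]
  · rw [Finset.prod_map]
    exact Finset.prod_congr rfl fun i _ => by simp [hv]
  · intro x hx
    obtain ⟨j, hj, hx⟩ := Finset.mem_biUnion.mp (Finsupp.support_finsetSum hx)
    have := Finsupp.support_single_subset hx
    simp at this
    simp [this]

theorem det_jtMatrix {R : Type*} [CommRing R] (n : ℕ) (lam : YoungDiagram) (h : ℕ → ℕ → R)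
    (h0 : ∀ j, h j 0 = 1) :
    (jtMatrix n lam h).det = jtSum n lam fun b => b.prod h := by
  rw [← Matrix.det_transpose, Matrix.det_apply]
  refine Finset.sum_congr rfl fun w _ => ?_
  rw [Units.smul_def]
  congr 1
  simp only [Matrix.transpose_apply, jtMatrix, Matrix.of_apply]
  split_ifs with hw
  · rw [finsupp_prod_sum_single n _ h h0]
    exact Finset.prod_congr rfl fun j _ => if_pos (hw j)
  · push Not at hw
    obtain ⟨j, hj⟩ := hw
    exact Finset.prod_eq_zero (Finset.mem_univ j) (if_neg (by omega))

theorem rowLen_eq_zero {lam : YoungDiagram} {n : ℕ} (hn : lam.colLen 0 ≤ n) : lam.rowLen n = 0 := by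
  by_contra h
  have : (n, 0) ∈ lam := YoungDiagram.mem_iff_lt_rowLen.mpr (Nat.pos_of_ne_zero h)
  have := YoungDiagram.mem_iff_lt_colLen.mp this
  omega

theorem det_jtMatrix_succ {R : Type*} [CommRing R] {n : ℕ} {lam : YoungDiagram} {h : ℕ → ℕ → R}
    (h0 : ∀ j, h j 0 = 1) (hn : lam.colLen 0 ≤ n) :
    (jtMatrix (n + 1) lam h).det = (jtMatrix n lam h).det := by
  have hz := rowLen_eq_zero hn
  rw [Matrix.det_succ_row _ (Fin.last n), Finset.sum_eq_single (Fin.last n)]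
  · have : (jtMatrix (n + 1) lam h).submatrix (Fin.last n).succAbove (Fin.last n).succAbove
        = jtMatrix n lam h := by
      ext i j
      simp [jtMatrix, Fin.succAbove_last]
    rw [this]
    simp [jtMatrix, hz, h0, ← two_mul]
  · intro k _ hk
    have : (k : ℕ) < n := Fin.val_lt_last hk
    simp [jtMatrix, hz, this]
  · simp

theorem map_jtSum {A B : Type*} [AddCommGroup A] [AddCommGroup B] (L : A →+ B) (n : ℕ)
    (lam : YoungDiagram) (v : (ℕ →₀ ℕ) → A) :
    L (jtSum n lam v) = jtSum n lam fun b => L (v b) := by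
  simp only [jtSum, map_sum, map_zsmul, apply_ite L, map_zero]

/-- Both sides are the images of determinants of monomials `z_j ^ r` under the additive map
`z ^ b ↦ v b`, so that the stability of the determinant carries over. -/
theorem jtSum_succ {A : Type*} [AddCommGroup A] {n : ℕ} {lam : YoungDiagram} (v : (ℕ →₀ ℕ) → A)
    (hn : lam.colLen 0 ≤ n) : jtSum (n + 1) lam v = jtSum n lam v := by
  have key : ∀ k, jtSum k lam v = (MvPolynomial.basisMonomials ℕ ℤ).constr ℤ v
      (jtMatrix k lam fun j r => (MvPolynomial.X j : MvPolynomial ℕ ℤ) ^ r).det := by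
    intro k
    rw [det_jtMatrix _ _ _ (fun j => pow_zero _), ← LinearMap.toAddMonoidHom_coe, map_jtSum]
    congr 1
    funext b
    have : (b.prod fun j r => (MvPolynomial.X j : MvPolynomial ℕ ℤ) ^ r)
        = MvPolynomial.basisMonomials ℕ ℤ b := by
      rw [MvPolynomial.coe_basisMonomials]
      exact MvPolynomial.prod_X_pow_eq_monomial
    rw [this, LinearMap.toAddMonoidHom_coe, Module.Basis.constr_basis]
  rw [key, key, det_jtMatrix_succ (fun j => pow_zero _) hn]

theorem jtSum_eq {A : Type*} [AddCommGroup A] {n : ℕ} {lam : YoungDiagram} (v : (ℕ →₀ ℕ) → A)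
    (hn : lam.colLen 0 ≤ n) : jtSum n lam v = jtSum (lam.colLen 0) lam v := by
  induction n, hn using Nat.le_induction with
  | base => rfl
  | succ n hn ih => rw [jtSum_succ v hn, ih]

/-! ### Complete homogeneous symmetric functions -/

/-- The complete homogeneous symmetric function `h_r` in the alphabet `τ`, the sum of all monomials
of degree `r`. -/
noncomputable def hsymmSeries (τ : Type*) (r : ℕ) : MvPowerSeries τ ℤ :=
  fun m => if m.degree = r then 1 else 0

theorem coeff_hsymmSeries {τ : Type*} (r : ℕ) (m : τ →₀ ℕ) :
    MvPowerSeries.coeff m (hsymmSeries τ r) = if m.degree = r then 1 else 0 := rfl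

theorem hsymmSeries_zero (τ : Type*) : hsymmSeries τ 0 = 1 := by
  classical
  ext m
  rw [coeff_hsymmSeries, MvPowerSeries.coeff_one]
  simp [Finsupp.degree_eq_zero_iff]

theorem killCompl_hsymmSeries {σ τ : Type*} (e : σ ↪ τ) (r : ℕ) :
    MvPowerSeries.killCompl e (hsymmSeries τ r) = hsymmSeries σ r := by
  ext m
  rw [MvPowerSeries.coeff_killCompl, coeff_hsymmSeries, coeff_hsymmSeries]
  congr 2
  rw [Finsupp.embDomain_eq_mapDomain]
  simp

/-- The generating function `∑ h_r t^r = ∏ (1 - x_l t)⁻¹` of a finite alphabet. -/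
theorem mk_hsymmSeries {τ : Type*} [Fintype τ] :
    PowerSeries.mk (hsymmSeries τ) =
      ∏ l : τ, PowerSeries.mk fun r => (MvPowerSeries.X l : MvPowerSeries τ ℤ) ^ r := by
  classical
  ext r m
  rw [PowerSeries.coeff_mk, PowerSeries.coeff_prod, map_sum]
  have : ∀ l ∈ (Finset.univ : Finset τ).finsuppAntidiag r,
      MvPowerSeries.coeff m (∏ i : τ, PowerSeries.coeff (l i)
        (PowerSeries.mk fun r => (MvPowerSeries.X i : MvPowerSeries τ ℤ) ^ r))
      = if m = l then 1 else 0 := by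
    intro l _
    simp only [PowerSeries.coeff_mk]
    rw [← MvPowerSeries.coeff_monomial, MvPowerSeries.monomial_one_eq, Finsupp.prod_fintype]
    simp
  rw [Finset.sum_congr rfl this, Finset.sum_ite_eq, coeff_hsymmSeries]
  simp [Finset.mem_finsuppAntidiag, Finsupp.degree_eq_sum]

theorem mk_pow_mul_one_sub {R : Type*} [CommRing R] (x : R) :
    (PowerSeries.mk fun r => x ^ r) * (1 - PowerSeries.C x * PowerSeries.X) = 1 := by
  ext r
  rcases r with _ | r
  · simp
  · simp [mul_sub, ← mul_assoc, PowerSeries.coeff_succ_mul_X, mul_comm _ (PowerSeries.C x),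
      PowerSeries.coeff_one, pow_succ, mul_comm x]

/-- The polynomial `∏_{l ≠ i} (1 - x_l t)` in `t`; its coefficients are, up to sign, the elementary
symmetric functions in the variables other than `x_i`. -/
noncomputable def omitPoly {n : ℕ} (i : Fin n) : Polynomial (MvPowerSeries (Fin n) ℤ) :=
  ∏ l ∈ Finset.univ.erase i, (1 - Polynomial.C (MvPowerSeries.X l) * Polynomial.X)

theorem natDegree_omitPoly {n : ℕ} (i : Fin n) : (omitPoly i).natDegree < n := by
  have h1 : (omitPoly i).natDegree ≤ ∑ l ∈ Finset.univ.erase i, 1 := by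
    refine (Polynomial.natDegree_prod_le _ _).trans (Finset.sum_le_sum fun l _ => ?_)
    refine (Polynomial.natDegree_sub_le _ _).trans (max_le (by simp) ?_)
    exact (Polynomial.natDegree_C_mul_le _ _).trans Polynomial.natDegree_X_le
  have : 0 < n := i.pos
  simp at h1
  omega

theorem mk_hsymmSeries_mul_omitPoly {n : ℕ} (i : Fin n) :
    PowerSeries.mk (hsymmSeries (Fin n)) * (omitPoly i : PowerSeries (MvPowerSeries (Fin n) ℤ)) =
      PowerSeries.mk fun r => (MvPowerSeries.X i : MvPowerSeries (Fin n) ℤ) ^ r := by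
  have h1 : (omitPoly i : PowerSeries (MvPowerSeries (Fin n) ℤ)) =
      ∏ l ∈ Finset.univ.erase i, (1 - PowerSeries.C (MvPowerSeries.X l) * PowerSeries.X) := by
    rw [omitPoly, ← Polynomial.coeToPowerSeries.ringHom_apply, map_prod]
    simp
  rw [mk_hsymmSeries, h1, ← Finset.mul_prod_erase _ _ (Finset.mem_univ i), mul_assoc,
    ← Finset.prod_mul_distrib, Finset.prod_congr rfl fun l _ => mk_pow_mul_one_sub _]
  simp

/-- The coefficient of `t ^ a` in `(∑ h_r t^r) ∏_{l ≠ i} (1 - x_l t) = (1 - x_i t)⁻¹`. -/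
theorem X_pow_eq_sum {n : ℕ} (i : Fin n) (a : ℕ) :
    (MvPowerSeries.X i : MvPowerSeries (Fin n) ℤ) ^ a =
      ∑ k : Fin n, (omitPoly i).coeff (n - 1 - k) *
        if n - 1 - (k : ℕ) ≤ a then hsymmSeries (Fin n) (a - (n - 1 - k)) else 0 := by
  have h := congrArg (PowerSeries.coeff a) (mk_hsymmSeries_mul_omitPoly i)
  rw [PowerSeries.coeff_mk, mul_comm, PowerSeries.coeff_mul] at h
  rw [← h, Finset.Nat.sum_antidiagonal_eq_sum_range_succ_mk]
  simp only [Polynomial.coeff_coe, PowerSeries.coeff_mk]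
  rw [← Equiv.sum_comp Fin.revPerm]
  have h2 : ∀ k : Fin n, n - 1 - ((Fin.revPerm k : Fin n) : ℕ) = k := fun k => by
    simp only [Fin.revPerm_apply, Fin.val_rev]; omega
  simp only [h2]
  rw [Fin.sum_univ_eq_sum_range (fun k => (omitPoly i).coeff k *
      if k ≤ a then hsymmSeries (Fin n) (a - k) else 0) n]
  simp only [mul_ite, mul_zero, ← Finset.sum_filter]
  refine (Finset.sum_subset (fun k hk => ?_) fun k hk hk' => ?_).symm
  · simp at hk ⊢; omega
  · simp at hk hk'
    have := natDegree_omitPoly i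
    have hlt : (omitPoly i).natDegree < k := by
      by_contra hc
      exact absurd (hk' (by omega)) (by omega)
    rw [Polynomial.coeff_eq_zero_of_natDegree_lt hlt, zero_mul]

/-- The alternant `a_{λ+ρ}(x_1, …, x_n)` as a power series in exactly `n` indeterminates. -/
noncomputable def alternantSeries (n : ℕ) (lam : YoungDiagram) : MvPowerSeries (Fin n) ℤ :=
  Matrix.det (Matrix.of fun i j : Fin n =>
    (MvPowerSeries.X i : MvPowerSeries (Fin n) ℤ) ^ (lam.rowLen j + (n - 1 - j)))

/-- The first factor is independent of `lam`; the identity for `lam = ⊥` shows that it is the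
Vandermonde determinant. -/
theorem alternantSeries_eq_det_mul (n : ℕ) (lam : YoungDiagram) :
    alternantSeries n lam = (Matrix.of fun i k : Fin n => (omitPoly i).coeff (n - 1 - k)).det *
      (jtMatrix n lam fun _ => hsymmSeries (Fin n)).det := by
  rw [← Matrix.det_transpose (jtMatrix _ _ _), ← Matrix.det_mul, alternantSeries]
  congr 1
  ext1 i j
  simp only [Matrix.of_apply, Matrix.mul_apply, Matrix.transpose_apply, jtMatrix]
  rw [X_pow_eq_sum]
  refine Finset.sum_congr rfl fun k _ => ?_
  have hj := j.isLt
  have hk := k.isLt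
  congr 1
  split_ifs
  · congr 1; omega
  · omega
  · omega
  · rfl

theorem rowLen_bot (j : ℕ) : (⊥ : YoungDiagram).rowLen j = 0 := by
  simp [YoungDiagram.rowLen]

theorem det_jtMatrix_bot {R : Type*} [CommRing R] (n : ℕ) (h : ℕ → ℕ → R) (h0 : ∀ j, h j 0 = 1) :
    (jtMatrix n ⊥ h).det = 1 := by
  have : (⊥ : YoungDiagram).colLen 0 = 0 := by simp [YoungDiagram.colLen]
  rw [det_jtMatrix _ _ _ h0, jtSum_eq _ (by simp [this]), this, ← det_jtMatrix _ _ _ h0]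
  simp

/-- The Jacobi–Trudi identity in `n` variables. -/
theorem alternantSeries_eq (n : ℕ) (lam : YoungDiagram) :
    alternantSeries n lam =
      alternantSeries n ⊥ * (jtMatrix n lam fun _ => hsymmSeries (Fin n)).det := by
  rw [alternantSeries_eq_det_mul n ⊥, det_jtMatrix_bot _ _ fun _ => hsymmSeries_zero _, mul_one,
    ← alternantSeries_eq_det_mul]

theorem alternantSeries_bot_ne_zero (n : ℕ) : alternantSeries n ⊥ ≠ 0 := by
  have : alternantSeries n ⊥ = ((Matrix.vandermonde fun i : Fin n =>
      (MvPowerSeries.X i : MvPowerSeries (Fin n) ℤ)).submatrix id Fin.revPerm).det := by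
    rw [alternantSeries]
    congr 1
    ext1 i j
    simp only [Matrix.of_apply, Matrix.submatrix_apply, Matrix.vandermonde_apply, rowLen_bot, id,
      Fin.revPerm_apply, Fin.val_rev]
    congr 1
    omega
  rw [this, Matrix.det_permute']
  refine mul_ne_zero ?_ ?_
  · rcases Int.units_eq_one_or (Equiv.Perm.sign (Fin.revPerm : Equiv.Perm (Fin n))) with h | h <;>
      simp [h]
  · have : IsDomain (MvPowerSeries (Fin n) ℤ) := NoZeroDivisors.to_isDomain _
    rw [Matrix.det_vandermonde_ne_zero_iff]
    exact fun i j h => MvPowerSeries.X_inj.mp h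

theorem killCompl_alternant (n : ℕ) (lam : YoungDiagram) :
    MvPowerSeries.killCompl Fin.valEmbedding (alternant n lam : MvPowerSeries ℕ ℤ) =
      alternantSeries n lam := by
  rw [alternant, alternantSeries, ← MvPolynomial.coeToMvPowerSeries.ringHom_apply,
    RingHom.map_det, AlgHom.map_det]
  congr 1
  ext1 i j
  simp only [AlgHom.mapMatrix_apply, RingHom.mapMatrix_apply, Matrix.map_apply, Matrix.of_apply,
    map_pow]
  rw [MvPolynomial.coeToMvPowerSeries.ringHom_apply, MvPolynomial.coe_X]
  exact congrArg (· ^ _) (MvPowerSeries.killCompl_X (e := Fin.valEmbedding) i)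

theorem map_det_jtMatrix {R S : Type*} [CommRing R] [CommRing S] (f : R →+* S) (n : ℕ)
    (lam : YoungDiagram) (h : ℕ → ℕ → R) :
    f (jtMatrix n lam h).det = (jtMatrix n lam fun j r => f (h j r)).det := by
  rw [RingHom.map_det]
  congr 1
  ext1 i j
  simp [jtMatrix, apply_ite f]

/-- The quotient defining the Schur polynomial is identified by cancelling the Vandermonde
determinant. -/
theorem killCompl_schurPoly (n : ℕ) (lam : YoungDiagram) :
    MvPowerSeries.killCompl Fin.valEmbedding (schurPoly n lam : MvPowerSeries ℕ ℤ) =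
      (jtMatrix n lam fun _ => hsymmSeries (Fin n)).det := by
  apply mul_left_cancel₀ (alternantSeries_bot_ne_zero n)
  rw [← alternantSeries_eq, ← killCompl_alternant, ← killCompl_alternant, alternant_eq n lam,
    MvPolynomial.coe_mul, map_mul]

theorem killCompl_det_jtMatrix (n k : ℕ) (lam : YoungDiagram) :
    MvPowerSeries.killCompl Fin.valEmbedding (jtMatrix k lam fun _ => hsymmSeries ℕ).det =
      (jtMatrix k lam fun _ => hsymmSeries (Fin n)).det := by
  have := map_det_jtMatrix (MvPowerSeries.killCompl (R := ℤ) (Fin.valEmbedding (n := n))).toRingHom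
    k lam fun _ => hsymmSeries ℕ
  refine this.trans ?_
  congr 2
  funext _ r
  exact killCompl_hsymmSeries _ r

theorem exists_embDomain {n : ℕ} {m : ℕ →₀ ℕ} (h : m.support ⊆ Finset.range n) :
    ∃ m' : Fin n →₀ ℕ, m'.embDomain Fin.valEmbedding = m := by
  have : m ∈ Set.range (Finsupp.embDomain (M := ℕ) (Fin.valEmbedding (n := n))) := by
    rw [Finsupp.mem_range_embDomain_iff]
    intro x hx
    exact ⟨⟨x, Finset.mem_range.mp (h hx)⟩, rfl⟩
  exact this

/-- The Jacobi–Trudi identity for universal Schur functions. A monomial involves finitely many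
indeterminates, so its coefficient can be read off in a finite alphabet. -/
theorem schurSeries_eq_det {n : ℕ} {lam : YoungDiagram} (hn : lam.colLen 0 ≤ n) :
    schurSeries lam = (jtMatrix n lam fun _ => hsymmSeries ℕ).det := by
  ext m
  have h0 : ∀ j : ℕ, (fun _ => hsymmSeries ℕ : ℕ → ℕ → MvPowerSeries ℕ ℤ) j 0 = 1 :=
    fun _ => hsymmSeries_zero _
  set N := max (lam.colLen 0) (m.support.sup Nat.succ) with hN
  obtain ⟨m', hm'⟩ : ∃ m' : Fin N →₀ ℕ, m'.embDomain Fin.valEmbedding = m := by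
    apply exists_embDomain
    intro x hx
    have := Finset.le_sup (f := Nat.succ) hx
    rw [Finset.mem_range]
    omega
  have h1 : MvPowerSeries.coeff m (schurSeries lam) =
      MvPowerSeries.coeff m (schurPoly N lam : MvPowerSeries ℕ ℤ) := by
    rw [MvPolynomial.coeff_coe]; rfl
  rw [h1, ← hm', ← MvPowerSeries.coeff_killCompl, ← MvPowerSeries.coeff_killCompl,
    killCompl_schurPoly, det_jtMatrix _ _ _ h0, jtSum_eq _ hn,
    ← jtSum_eq _ (le_max_left _ _ : lam.colLen 0 ≤ N), ← det_jtMatrix _ _ _ h0,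
    killCompl_det_jtMatrix]

/-! ### Symmetric and homogeneous power series -/

/-- The power series invariant under all permutations of the alphabet `τ`. No bound on the degree is
imposed: for `τ = ℕ` this is a completion of the ring of symmetric functions. -/
def symmetricSeries (τ : Type*) : Subalgebra ℤ (MvPowerSeries τ ℤ) where
  carrier := {f | ∀ e : Equiv.Perm τ, MvPowerSeries.rename e f = f}
  mul_mem' hf hg e := by rw [map_mul, hf e, hg e]
  add_mem' hf hg e := by rw [map_add, hf e, hg e]
  algebraMap_mem' r e := AlgHom.commutes _ r

theorem coeff_embDomain_equiv {σ τ : Type*} (e : σ ≃ τ) (f : MvPowerSeries σ ℤ) (m : σ →₀ ℕ) :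
    MvPowerSeries.coeff (m.embDomain e.toEmbedding) (MvPowerSeries.rename e f) =
      MvPowerSeries.coeff m f :=
  MvPowerSeries.coeff_embDomain_rename e.toEmbedding f m

theorem exists_embDomain_equiv {σ τ : Type*} (e : σ ≃ τ) (m : τ →₀ ℕ) :
    ∃ m' : σ →₀ ℕ, m'.embDomain e.toEmbedding = m := by
  have : m ∈ Set.range (Finsupp.embDomain (M := ℕ) e.toEmbedding) := by
    rw [Finsupp.mem_range_embDomain_iff]
    intro x _
    exact ⟨e.symm x, by simp⟩
  exact this

theorem coeff_embDomain_of_mem {τ : Type*} {f : MvPowerSeries τ ℤ} (hf : f ∈ symmetricSeries τ)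
    (e : Equiv.Perm τ) (m : τ →₀ ℕ) :
    MvPowerSeries.coeff (m.embDomain e.toEmbedding) f = MvPowerSeries.coeff m f := by
  conv_lhs => rw [← hf e]
  exact coeff_embDomain_equiv e f m

theorem mem_symmetricSeries_of_coeff {τ : Type*} {f : MvPowerSeries τ ℤ}
    (hf : ∀ (e : Equiv.Perm τ) (m : τ →₀ ℕ),
      MvPowerSeries.coeff (m.embDomain e.toEmbedding) f = MvPowerSeries.coeff m f) :
    f ∈ symmetricSeries τ := by
  intro e
  ext m
  obtain ⟨m', rfl⟩ := exists_embDomain_equiv e m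
  rw [coeff_embDomain_equiv, hf]

theorem embDomain_symm_apply {τ : Type*} (w : Equiv.Perm τ) (m : τ →₀ ℕ) (j : τ) :
    m.embDomain w.symm.toEmbedding j = m (w j) := by
  conv_lhs => rw [← w.symm_apply_apply j]
  exact Finsupp.embDomain_apply_self w.symm.toEmbedding m (w j)

theorem degree_embDomain {σ τ : Type*} (e : σ ↪ τ) (m : σ →₀ ℕ) :
    (m.embDomain e).degree = m.degree := by
  rw [Finsupp.embDomain_eq_mapDomain]
  simp

theorem hsymmSeries_mem (τ : Type*) (r : ℕ) : hsymmSeries τ r ∈ symmetricSeries τ :=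
  mem_symmetricSeries_of_coeff fun e m => by
    rw [coeff_hsymmSeries, coeff_hsymmSeries, degree_embDomain]

/-- All monomials of `f` have degree `d`. -/
def IsHomogeneousSeries {τ : Type*} (d : ℕ) (f : MvPowerSeries τ ℤ) : Prop :=
  ∀ m : τ →₀ ℕ, m.degree ≠ d → MvPowerSeries.coeff m f = 0

theorem IsHomogeneousSeries.mul {τ : Type*} {d d' : ℕ} {f g : MvPowerSeries τ ℤ}
    (hf : IsHomogeneousSeries d f) (hg : IsHomogeneousSeries d' g) :
    IsHomogeneousSeries (d + d') (f * g) := by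
  classical
  intro m hm
  rw [MvPowerSeries.coeff_mul]
  refine Finset.sum_eq_zero fun p hp => ?_
  rw [Finset.HasAntidiagonal.mem_antidiagonal] at hp
  by_cases h1 : p.1.degree = d
  · rw [hg p.2 fun h2 => hm (by rw [← hp, map_add, h1, h2]), mul_zero]
  · rw [hf p.1 h1, zero_mul]

theorem isHomogeneousSeries_hsymmSeries (τ : Type*) (r : ℕ) :
    IsHomogeneousSeries r (hsymmSeries τ r) := fun _ hm => if_neg hm

theorem isHomogeneousSeries_one {τ : Type*} :
    IsHomogeneousSeries 0 (1 : MvPowerSeries τ ℤ) := by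
  rw [← hsymmSeries_zero]
  exact isHomogeneousSeries_hsymmSeries τ 0

/-- The product `∏_j h_{b j}` of complete homogeneous symmetric functions. -/
noncomputable def hsymmProd (b : ℕ →₀ ℕ) : MvPowerSeries ℕ ℤ := b.prod fun _ r => hsymmSeries ℕ r

theorem hsymmProd_mem (b : ℕ →₀ ℕ) : hsymmProd b ∈ symmetricSeries ℕ :=
  prod_mem fun _ _ => hsymmSeries_mem ℕ _

theorem isHomogeneousSeries_hsymmProd (b : ℕ →₀ ℕ) :
    IsHomogeneousSeries b.degree (hsymmProd b) := by
  have : ∀ s : Finset ℕ, IsHomogeneousSeries (∑ i ∈ s, b i) (∏ i ∈ s, hsymmSeries ℕ (b i)) := by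
    intro s
    induction s using Finset.induction_on with
    | empty => simpa using isHomogeneousSeries_one
    | insert i s hi ih =>
      rw [Finset.sum_insert hi, Finset.prod_insert hi]
      exact (isHomogeneousSeries_hsymmSeries ℕ _).mul ih
  exact this b.support

/-! ### The coefficient functionals -/

theorem card_eq_sum_rowLen {n : ℕ} {lam : YoungDiagram} (hn : lam.colLen 0 ≤ n) :
    lam.card = ∑ j : Fin n, lam.rowLen j := by
  rw [Fin.sum_univ_eq_sum_range (fun j => lam.rowLen j) n, YoungDiagram.card,
    Finset.card_eq_sum_card_fiberwise (f := Prod.fst) (t := Finset.range n)]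
  · exact Finset.sum_congr rfl fun j _ => (lam.rowLen_eq_card).symm
  · rintro ⟨i, j⟩ h
    have h1 : (i, j) ∈ lam := h
    have h2 : (i, 0) ∈ lam := lam.up_left_mem le_rfl (Nat.zero_le j) h1
    have := YoungDiagram.mem_iff_lt_colLen.mp h2
    simp
    omega

/-- All exponent vectors in the Jacobi–Trudi expansion of `lam` have degree `|λ|`. -/
theorem jtSum_congr {A : Type*} [AddCommGroup A] {n : ℕ} {lam : YoungDiagram}
    (hn : lam.colLen 0 ≤ n) {v v' : (ℕ →₀ ℕ) → A}
    (h : ∀ b : ℕ →₀ ℕ, b.degree = lam.card → v b = v' b) :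
    jtSum n lam v = jtSum n lam v' := by
  refine Finset.sum_congr rfl fun w _ => ?_
  congr 1
  split_ifs with hw
  · apply h
    rw [map_sum, card_eq_sum_rowLen hn]
    simp only [Finsupp.degree_single]
    have h1 : ∑ j : Fin n, ((w j : Fin n) : ℕ) = ∑ j : Fin n, (j : ℕ) :=
      Equiv.sum_comp w fun j => (j : ℕ)
    have h2 : ∑ j : Fin n, (lam.rowLen j + w j - j) + ∑ j : Fin n, (j : ℕ) =
        ∑ j : Fin n, lam.rowLen j + ∑ j : Fin n, ((w j : Fin n) : ℕ) := by
      rw [← Finset.sum_add_distrib, ← Finset.sum_add_distrib]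
      exact Finset.sum_congr rfl fun j _ => Nat.sub_add_cancel (hw j)
    omega
  · rfl

/-- The functional that extracts the coefficient of `s_λ` from a symmetric power series. It is
defined on all power series, as the Jacobi–Trudi expansion of the coefficients of monomials, and it
is the coefficient of `x ^ (λ + ρ)` in the product with the Vandermonde determinant
(`coeff_alternantSeries_mul`). -/
noncomputable def schurFunctional (lam : YoungDiagram) : MvPowerSeries ℕ ℤ →ₗ[ℤ] ℤ where
  toFun g := jtSum (lam.colLen 0) lam fun b => MvPowerSeries.coeff b g
  map_add' f g := by
    simp only [jtSum, ← Finset.sum_add_distrib, ← smul_add]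
    refine Finset.sum_congr rfl fun w _ => ?_
    split_ifs <;> simp
  map_smul' c g := by
    simp only [jtSum, Finset.smul_sum]
    refine Finset.sum_congr rfl fun w _ => ?_
    split_ifs
    · rw [map_smul]; simp only [smul_eq_mul, RingHom.id_apply]; ring
    · simp

theorem schurFunctional_eq_jtSum {n : ℕ} {lam : YoungDiagram} (hn : lam.colLen 0 ≤ n)
    (g : MvPowerSeries ℕ ℤ) :
    schurFunctional lam g = jtSum n lam fun b => MvPowerSeries.coeff b g :=
  (jtSum_eq _ hn).symm

theorem schurFunctional_congr {lam : YoungDiagram} {f g : MvPowerSeries ℕ ℤ}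
    (h : ∀ b : ℕ →₀ ℕ, b.degree = lam.card → MvPowerSeries.coeff b f = MvPowerSeries.coeff b g) :
    schurFunctional lam f = schurFunctional lam g :=
  jtSum_congr le_rfl h

theorem schurSeries_eq_jtSum {n : ℕ} {lam : YoungDiagram} (hn : lam.colLen 0 ≤ n) :
    schurSeries lam = jtSum n lam hsymmProd := by
  rw [schurSeries_eq_det hn, det_jtMatrix _ _ _ fun _ => hsymmSeries_zero _]
  rfl

theorem coeff_schurSeries (lam : YoungDiagram) (m : ℕ →₀ ℕ) :
    MvPowerSeries.coeff m (schurSeries lam) =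
      jtSum (lam.colLen 0) lam fun b => MvPowerSeries.coeff m (hsymmProd b) := by
  rw [schurSeries_eq_jtSum le_rfl, ← LinearMap.toAddMonoidHom_coe, map_jtSum]

theorem schurSeries_mem (lam : YoungDiagram) : schurSeries lam ∈ symmetricSeries ℕ := by
  rw [schurSeries_eq_jtSum le_rfl]
  refine sum_mem fun w _ => zsmul_mem ?_ _
  split_ifs
  · exact hsymmProd_mem _
  · exact zero_mem _

theorem isHomogeneousSeries_schurSeries (lam : YoungDiagram) :
    IsHomogeneousSeries lam.card (schurSeries lam) := by
  intro m hm
  rw [coeff_schurSeries, jtSum_congr le_rfl (v' := fun _ => 0)]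
  · simp [jtSum]
  · intro b hb
    exact isHomogeneousSeries_hsymmProd b m (by rwa [hb])

/-! ### Alternants -/

/-- The exponent vector `λ + ρ`, with entries `λ_{i+1} + n - 1 - i`. -/
noncomputable def shiftedExponent (n : ℕ) (lam : YoungDiagram) : Fin n →₀ ℕ :=
  Finsupp.equivFunOnFinite.symm fun i => lam.rowLen i + (n - 1 - i)

theorem shiftedExponent_apply (n : ℕ) (lam : YoungDiagram) (i : Fin n) :
    shiftedExponent n lam i = lam.rowLen i + (n - 1 - i) := rfl

theorem shiftedExponent_strictAnti (n : ℕ) (lam : YoungDiagram) :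
    StrictAnti (shiftedExponent n lam) := by
  intro i j hij
  have := lam.rowLen_anti i j (le_of_lt hij)
  have hj := j.isLt
  have : (i : ℕ) < j := hij
  rw [shiftedExponent_apply, shiftedExponent_apply]
  omega

theorem alternantSeries_eq_sum (n : ℕ) (lam : YoungDiagram) :
    alternantSeries n lam = ∑ w : Equiv.Perm (Fin n), (Equiv.Perm.sign w : ℤ) •
      MvPowerSeries.monomial ((shiftedExponent n lam).embDomain w.symm.toEmbedding) (1 : ℤ) := by
  rw [alternantSeries, ← Matrix.det_transpose, Matrix.det_apply]
  refine Finset.sum_congr rfl fun w _ => ?_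
  rw [Units.smul_def]
  congr 1
  rw [MvPowerSeries.monomial_one_eq, Finsupp.prod_fintype _ _ (fun _ => pow_zero _)]
  refine Finset.prod_congr rfl fun i _ => ?_
  simp only [Matrix.transpose_apply, Matrix.of_apply]
  congr 1
  exact (embDomain_symm_apply w (shiftedExponent n lam) i).symm

/-- Expanding the Vandermonde determinant `a_ρ`, the permutation `w` contributes the coefficient of
`x ^ (λ + ρ - w ρ)` in `g`, which is a term of the Jacobi–Trudi expansion. -/
theorem coeff_alternantSeries_mul {n : ℕ} {lam : YoungDiagram} (hn : lam.colLen 0 ≤ n)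
    (g : MvPowerSeries ℕ ℤ) :
    MvPowerSeries.coeff (shiftedExponent n lam)
      (alternantSeries n ⊥ * MvPowerSeries.killCompl Fin.valEmbedding g) =
      schurFunctional lam g := by
  rw [schurFunctional_eq_jtSum hn, alternantSeries_eq_sum, Finset.sum_mul, map_sum, jtSum]
  refine Finset.sum_congr rfl fun w _ => ?_
  rw [smul_mul_assoc, map_zsmul]
  congr 1
  rw [MvPowerSeries.coeff_monomial_mul, one_mul, MvPowerSeries.coeff_killCompl]
  have hw : ∀ j : Fin n, (shiftedExponent n ⊥).embDomain w.symm.toEmbedding j = n - 1 - w j := by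
    intro j
    rw [embDomain_symm_apply, shiftedExponent_apply, rowLen_bot, zero_add]
  have hiff : (shiftedExponent n ⊥).embDomain w.symm.toEmbedding ≤ shiftedExponent n lam ↔
      ∀ j : Fin n, (j : ℕ) ≤ lam.rowLen j + w j := by
    rw [Finsupp.le_def]
    refine forall_congr' fun j => ?_
    have hj := j.isLt
    have hwj := (w j).isLt
    rw [hw, shiftedExponent_apply]
    omega
  simp only [hiff]
  split_ifs with h
  · congr 1
    rw [← Finsupp.univ_sum_single (shiftedExponent n lam - _), Finsupp.embDomain_eq_mapDomain,
      Finsupp.mapDomain_finsetSum]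
    simp only [Finsupp.mapDomain_single]
    congr 1
    refine Finset.sum_congr rfl fun j _ => ?_
    have hj := j.isLt
    have hwj := (w j).isLt
    rw [Finsupp.tsub_apply, hw, shiftedExponent_apply]
    congr 1
    have := h j
    omega
  · rfl

theorem perm_eq_one_of_strictMono {n : ℕ} {w : Equiv.Perm (Fin n)} (hw : StrictMono w) : w = 1 := by
  ext1 i
  exact congrFun ((hw.range_inj strictMono_id).mp (by simp [w.surjective.range_eq])) i

theorem rowLen_injective {lam mu : YoungDiagram} (h : ∀ j, lam.rowLen j = mu.rowLen j) :
    lam = mu := by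
  ext ⟨i, j⟩
  rw [YoungDiagram.mem_cells, YoungDiagram.mem_cells, YoungDiagram.mem_iff_lt_rowLen,
    YoungDiagram.mem_iff_lt_rowLen, h]

/-- Since `a_ρ s_μ = a_{μ+ρ}`, this says that `a_{μ+ρ}` contains exactly one monomial with strictly
decreasing exponents, namely `x ^ (μ + ρ)`. -/
theorem schurFunctional_schurSeries [DecidableEq YoungDiagram] (lam mu : YoungDiagram) :
    schurFunctional lam (schurSeries mu) = if lam = mu then 1 else 0 := by
  classical
  set n := max (lam.colLen 0) (mu.colLen 0)
  have hl : lam.colLen 0 ≤ n := le_max_left _ _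
  have hm : mu.colLen 0 ≤ n := le_max_right _ _
  rw [← coeff_alternantSeries_mul hl, schurSeries_eq_det hm, killCompl_det_jtMatrix,
    ← alternantSeries_eq, alternantSeries_eq_sum, map_sum]
  simp only [map_zsmul, MvPowerSeries.coeff_monomial]
  have key : ∀ w : Equiv.Perm (Fin n),
      shiftedExponent n lam = (shiftedExponent n mu).embDomain w.symm.toEmbedding →
      w = 1 ∧ lam = mu := by
    intro w h
    have hw : ∀ j : Fin n, shiftedExponent n lam j = shiftedExponent n mu (w j) := by
      intro j
      rw [h, embDomain_symm_apply]
    have h1 : w = 1 := by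
      apply perm_eq_one_of_strictMono
      intro i j hij
      have := shiftedExponent_strictAnti n lam hij
      rw [hw, hw] at this
      exact (shiftedExponent_strictAnti n mu).lt_iff_gt.mp this
    refine ⟨h1, rowLen_injective fun j => ?_⟩
    by_cases hj : j < n
    · have := hw ⟨j, hj⟩
      rw [h1] at this
      simpa [shiftedExponent_apply] using this
    · rw [rowLen_eq_zero (by omega), rowLen_eq_zero (by omega)]
  rw [Finset.sum_eq_single 1]
  · split_ifs with h1 h2 h2
    · simp
    · exact absurd (key _ h1).2 h2
    · exact absurd (by rw [h2]; ext1 j; exact (embDomain_symm_apply 1 _ j).symm) h1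
    · simp
  · intro w _ hw
    rw [if_neg fun h => hw (key w h).1, smul_zero]
  · simp

/-! ### Expansion of symmetric power series in Schur functions -/

theorem rename_alternantSeries {n : ℕ} (w : Equiv.Perm (Fin n)) (lam : YoungDiagram) :
    MvPowerSeries.rename w (alternantSeries n lam) =
      (Equiv.Perm.sign w : ℤ) • alternantSeries n lam := by
  have : MvPowerSeries.rename w (alternantSeries n lam) = ((Matrix.of fun i j : Fin n =>
      (MvPowerSeries.X i : MvPowerSeries (Fin n) ℤ) ^
        (lam.rowLen j + (n - 1 - j))).submatrix w id).det := by
    rw [alternantSeries, AlgHom.map_det]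
    congr 1
    ext1 i j
    simp
  rw [this, Matrix.det_permute, ← alternantSeries, zsmul_eq_mul]

theorem coeff_embDomain_alternantSeries_mul {n : ℕ} (lam : YoungDiagram)
    {g : MvPowerSeries (Fin n) ℤ} (hg : g ∈ symmetricSeries (Fin n)) (w : Equiv.Perm (Fin n))
    (m : Fin n →₀ ℕ) :
    MvPowerSeries.coeff m (alternantSeries n lam * g) = (Equiv.Perm.sign w : ℤ) *
      MvPowerSeries.coeff (m.embDomain w.toEmbedding) (alternantSeries n lam * g) := by
  have h := coeff_embDomain_equiv w (alternantSeries n lam * g) m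
  rw [map_mul, rename_alternantSeries, hg w, smul_mul_assoc, map_zsmul, smul_eq_mul] at h
  exact h.symm

theorem exists_rowLen_eq {n : ℕ} (f : Fin n → ℕ) (hf : Antitone f) :
    ∃ lam : YoungDiagram, lam.colLen 0 ≤ n ∧ ∀ i : Fin n, lam.rowLen i = f i := by
  have hs : (List.ofFn f).SortedGE := by
    rw [List.sortedGE_ofFn_iff]
    exact hf
  refine ⟨YoungDiagram.ofRowLens (List.ofFn f) hs, ?_, fun i => ?_⟩
  · by_contra h
    push Not at h
    have := YoungDiagram.mem_iff_lt_colLen.mpr h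
    rw [YoungDiagram.mem_ofRowLens] at this
    obtain ⟨h1, _⟩ := this
    simp at h1
  · have := YoungDiagram.rowLen_ofRowLens (hw := hs) (i.cast (by simp))
    simpa using this

/-- Exponent vectors with distinct entries become, after sorting, of the form `λ + ρ`. -/
theorem exists_shiftedExponent {n : ℕ} {m : Fin n →₀ ℕ} (hm : Function.Injective m) :
    ∃ (lam : YoungDiagram) (w : Equiv.Perm (Fin n)), lam.colLen 0 ≤ n ∧
      m.embDomain w.toEmbedding = shiftedExponent n lam := by
  set w : Equiv.Perm (Fin n) := Tuple.sort fun i => OrderDual.toDual (m i)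
  have hanti : StrictAnti fun i => m (w i) := by
    have h1 : Monotone ((fun i => OrderDual.toDual (m i)) ∘ w) :=
      Tuple.monotone_sort fun i => OrderDual.toDual (m i)
    have h2 : Antitone fun i => m (w i) := fun i j hij => h1 hij
    exact h2.strictAnti_of_injective (hm.comp w.injective)
  -- Distinct decreasing entries drop by at least one at each step.
  have hge : ∀ (k : ℕ) (i j : Fin n), (j : ℕ) = i + k → m (w j) + k ≤ m (w i) := by
    intro k
    induction k with
    | zero => intro i j h; rw [Fin.ext h]; simp
    | succ k ih =>
      intro i j h
      have hj := j.isLt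
      have h1 := ih i ⟨i + k, by omega⟩ rfl
      have h2 := @hanti ⟨i + k, by omega⟩ j (Fin.lt_def.mpr (by simp; omega))
      simp only at h2
      omega
  obtain ⟨lam, hl, hrow⟩ := exists_rowLen_eq (fun i : Fin n => m (w i) - (n - 1 - i)) (by
    intro i j hij
    have hi := hge (j - i) i j (by have : (i : ℕ) ≤ j := hij; omega)
    have : (i : ℕ) ≤ j := hij
    have hj := j.isLt
    simp only
    omega)
  refine ⟨lam, w.symm, hl, ?_⟩
  ext i
  have hi := i.isLt
  rw [embDomain_symm_apply, shiftedExponent_apply, hrow]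
  have := hge (n - 1 - i) i ⟨n - 1, by omega⟩ (by simp; omega)
  omega

/-- The product of a symmetric series with the Vandermonde determinant is alternating, and an
alternating series is determined by its coefficients at the vectors `λ + ρ`. -/
theorem eq_zero_of_coeff_alternantSeries_mul {n : ℕ} {g : MvPowerSeries (Fin n) ℤ}
    (hg : g ∈ symmetricSeries (Fin n))
    (h : ∀ lam : YoungDiagram, lam.colLen 0 ≤ n →
      MvPowerSeries.coeff (shiftedExponent n lam) (alternantSeries n ⊥ * g) = 0) : g = 0 := by
  have h0 : alternantSeries n ⊥ * g = 0 := by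
    ext m
    rw [map_zero]
    by_cases hm : Function.Injective m
    · obtain ⟨lam, w, hl, hw⟩ := exists_shiftedExponent hm
      rw [coeff_embDomain_alternantSeries_mul ⊥ hg w, hw, h lam hl, mul_zero]
    · obtain ⟨i, j, hij, hne⟩ : ∃ i j, m i = m j ∧ i ≠ j := by
        simpa [Function.Injective] using hm
      -- Two equal exponents make the coefficient its own negative.
      have h1 := coeff_embDomain_alternantSeries_mul ⊥ hg (Equiv.swap i j) m
      have h2 : m.embDomain (Equiv.swap i j).toEmbedding = m := by
        ext k
        have := embDomain_symm_apply (Equiv.swap i j) m k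
        rw [Equiv.symm_swap] at this
        rw [this, Equiv.swap_apply_def]
        split_ifs with hi hj
        · rw [hi, hij]
        · rw [hj, hij]
        · rfl
      rw [h2, Equiv.Perm.sign_swap hne] at h1
      simp at h1
      omega
  exact (mul_eq_zero.mp h0).resolve_left (alternantSeries_bot_ne_zero n)

theorem killCompl_mem_symmetricSeries {g : MvPowerSeries ℕ ℤ} (hg : g ∈ symmetricSeries ℕ) (n : ℕ) :
    MvPowerSeries.killCompl (Fin.valEmbedding (n := n)) g ∈ symmetricSeries (Fin n) := by
  refine mem_symmetricSeries_of_coeff fun e m => ?_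
  rw [MvPowerSeries.coeff_killCompl, MvPowerSeries.coeff_killCompl,
    ← coeff_embDomain_of_mem hg (e.extendDomain Fin.equivSubtype) (m.embDomain Fin.valEmbedding)]
  congr 1
  simp only [Finsupp.embDomain_eq_mapDomain, ← Finsupp.mapDomain_comp]
  exact congrArg (fun f => MvPowerSeries.coeff (Finsupp.mapDomain f m))
    (funext fun i => (Equiv.Perm.extendDomain_apply_image e Fin.equivSubtype i).symm)

theorem eq_of_schurFunctional_eq {f g : MvPowerSeries ℕ ℤ} (hf : f ∈ symmetricSeries ℕ)
    (hg : g ∈ symmetricSeries ℕ) (h : ∀ lam, schurFunctional lam f = schurFunctional lam g) :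
    f = g := by
  rw [← sub_eq_zero]
  ext m
  obtain ⟨m', hm'⟩ : ∃ m' : Fin (m.support.sup Nat.succ) →₀ ℕ,
      m'.embDomain Fin.valEmbedding = m := by
    apply exists_embDomain
    intro x hx
    have := Finset.le_sup (f := Nat.succ) hx
    rw [Finset.mem_range]
    omega
  rw [← hm', ← MvPowerSeries.coeff_killCompl, eq_zero_of_coeff_alternantSeries_mul
    (killCompl_mem_symmetricSeries (sub_mem hf hg) _), map_zero, map_zero]
  intro lam hlam
  rw [coeff_alternantSeries_mul hlam, map_sub, h, sub_self]

theorem finite_setOf_card_le (d : ℕ) : {lam : YoungDiagram | lam.card ≤ d}.Finite := by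
  have hfin : Set.Finite {c : Finset (ℕ × ℕ) | c ⊆ Finset.range d ×ˢ Finset.range d} := by
    simpa [← Finset.mem_powerset] using
      (Finset.finite_toSet (Finset.range d ×ˢ Finset.range d : Finset (ℕ × ℕ)).powerset)
  refine (hfin.preimage (f := YoungDiagram.cells) fun a _ b _ h => YoungDiagram.ext h).subset ?_
  rintro lam hlam ⟨i, j⟩ hij
  have hij : (i, j) ∈ lam := hij
  have h1 : lam.rowLen i ≤ lam.card := by
    rw [lam.rowLen_eq_card]; exact Finset.card_le_card (Finset.filter_subset _ _)
  have h2 : lam.colLen j ≤ lam.card := by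
    rw [lam.colLen_eq_card]; exact Finset.card_le_card (Finset.filter_subset _ _)
  have h3 := YoungDiagram.mem_iff_lt_rowLen.mp hij
  have h4 := YoungDiagram.mem_iff_lt_colLen.mp hij
  have h5 : lam.card ≤ d := hlam
  simp
  omega

/-- The partitions of all numbers at most `d`. -/
noncomputable def partitionsLE (d : ℕ) : Finset YoungDiagram := (finite_setOf_card_le d).toFinset

theorem mem_partitionsLE {d : ℕ} {lam : YoungDiagram} : lam ∈ partitionsLE d ↔ lam.card ≤ d := by
  simp [partitionsLE]

/-- The possibly infinite sum `∑_λ c_λ s_λ`, which is finite in each degree. -/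
noncomputable def schurSum (c : YoungDiagram → ℤ) : MvPowerSeries ℕ ℤ := fun m =>
  ∑ lam ∈ partitionsLE m.degree, c lam * MvPowerSeries.coeff m (schurSeries lam)

theorem coeff_schurSum {d : ℕ} (c : YoungDiagram → ℤ) {m : ℕ →₀ ℕ} (hm : m.degree ≤ d) :
    MvPowerSeries.coeff m (schurSum c) =
      ∑ lam ∈ partitionsLE d, c lam * MvPowerSeries.coeff m (schurSeries lam) := by
  refine Finset.sum_subset (fun lam h => ?_) fun lam _ h => ?_
  · rw [mem_partitionsLE] at h ⊢
    omega
  · rw [mem_partitionsLE] at h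
    rw [isHomogeneousSeries_schurSeries lam m (by omega), mul_zero]

theorem schurSum_mem (c : YoungDiagram → ℤ) : schurSum c ∈ symmetricSeries ℕ := by
  refine mem_symmetricSeries_of_coeff fun e m => ?_
  rw [coeff_schurSum c (degree_embDomain _ m).le, coeff_schurSum c le_rfl]
  refine Finset.sum_congr rfl fun lam _ => ?_
  rw [coeff_embDomain_of_mem (schurSeries_mem lam)]

theorem schurFunctional_sum_schurSeries (c : YoungDiagram → ℤ) (s : Finset YoungDiagram)
    (lam : YoungDiagram) [Decidable (lam ∈ s)] :
    schurFunctional lam (∑ mu ∈ s, c mu • schurSeries mu) = if lam ∈ s then c lam else 0 := by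
  classical
  simp only [map_sum, map_smul, schurFunctional_schurSeries, smul_eq_mul, mul_ite, mul_one,
    mul_zero, Finset.sum_ite_eq]
  congr

theorem schurFunctional_schurSum (c : YoungDiagram → ℤ) (lam : YoungDiagram) :
    schurFunctional lam (schurSum c) = c lam := by
  classical
  have := schurFunctional_sum_schurSeries c (partitionsLE lam.card) lam
  rw [if_pos (mem_partitionsLE.mpr le_rfl)] at this
  rw [← this]
  refine schurFunctional_congr fun b hb => ?_
  rw [coeff_schurSum c hb.le, map_sum]
  exact Finset.sum_congr rfl fun mu _ => (map_smul (MvPowerSeries.coeff b) _ _).symm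

theorem schurSum_schurFunctional {f : MvPowerSeries ℕ ℤ} (hf : f ∈ symmetricSeries ℕ) :
    schurSum (fun lam => schurFunctional lam f) = f :=
  eq_of_schurFunctional_eq (schurSum_mem _) hf fun lam => schurFunctional_schurSum _ lam

theorem coeff_eq_sum_schurFunctional {d : ℕ} {f : MvPowerSeries ℕ ℤ} (hf : f ∈ symmetricSeries ℕ)
    {m : ℕ →₀ ℕ} (hm : m.degree ≤ d) :
    MvPowerSeries.coeff m f =
      ∑ lam ∈ partitionsLE d, schurFunctional lam f * MvPowerSeries.coeff m (schurSeries lam) := by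
  rw [← coeff_schurSum _ hm, schurSum_schurFunctional hf]

theorem schurFunctional_eq_zero {d : ℕ} {f : MvPowerSeries ℕ ℤ} (hf : IsHomogeneousSeries d f)
    {lam : YoungDiagram} (h : lam.card ≠ d) : schurFunctional lam f = 0 := by
  rw [schurFunctional_congr (g := 0) fun b hb => hf b (by omega), map_zero]

/-! ### Schur functions as a basis of the ring of symmetric functions -/

theorem eq_sum_schurSeries {f : MvPowerSeries ℕ ℤ} (hf : f ∈ symmetricSeries ℕ)
    {s : Finset YoungDiagram} (hs : ∀ lam ∉ s, schurFunctional lam f = 0) :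
    f = ∑ lam ∈ s, schurFunctional lam f • schurSeries lam := by
  classical
  refine eq_of_schurFunctional_eq hf
    (sum_mem fun lam _ => zsmul_mem (schurSeries_mem lam) _) fun lam => ?_
  rw [schurFunctional_sum_schurSeries (fun lam => schurFunctional lam f)]
  split_ifs with h
  · rfl
  · exact hs lam h

theorem schurSeries_mul (lam mu : YoungDiagram) :
    schurSeries lam * schurSeries mu = ∑ nu ∈ partitionsLE (lam.card + mu.card),
      schurFunctional nu (schurSeries lam * schurSeries mu) • schurSeries nu := by
  refine eq_sum_schurSeries (mul_mem (schurSeries_mem lam) (schurSeries_mem mu)) fun nu hnu => ?_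
  rw [mem_partitionsLE] at hnu
  exact schurFunctional_eq_zero
    ((isHomogeneousSeries_schurSeries lam).mul (isHomogeneousSeries_schurSeries mu)) (by omega)

theorem schurSeries_bot : schurSeries ⊥ = 1 := by
  rw [schurSeries_eq_det (n := 0) (by simp [YoungDiagram.colLen])]
  simp

theorem exists_linearCombination_schur (X : symmetricFunctions) :
    ∃ a : YoungDiagram →₀ ℤ, Finsupp.linearCombination ℤ schur a = X := by
  have hspan : ∀ f ∈ symmetricFunctions, f ∈ Submodule.span ℤ (Set.range schurSeries) := by
    intro f hf
    refine Algebra.adjoin_induction (fun x hx => Submodule.subset_span hx) ?_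
      (fun x y _ _ hx hy => add_mem hx hy) ?_ hf
    · intro r
      rw [Algebra.algebraMap_eq_smul_one, ← schurSeries_bot]
      exact Submodule.smul_mem _ _ (Submodule.subset_span ⟨⊥, rfl⟩)
    · intro x y hx' hy' hx hy
      clear hx' hy'
      induction hx using Submodule.span_induction with
      | zero => simp
      | add _ _ _ _ h h' => rw [add_mul]; exact add_mem h h'
      | smul c _ _ h => rw [smul_mul_assoc]; exact Submodule.smul_mem _ _ h
      | mem x hx =>
      induction hy using Submodule.span_induction with
      | zero => simp
      | add _ _ _ _ h h' => rw [mul_add]; exact add_mem h h'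
      | smul c _ _ h => rw [mul_smul_comm]; exact Submodule.smul_mem _ _ h
      | mem y hy =>
      obtain ⟨lam, rfl⟩ := hx
      obtain ⟨mu, rfl⟩ := hy
      rw [schurSeries_mul]
      exact sum_mem fun nu _ => Submodule.smul_mem _ _ (Submodule.subset_span ⟨nu, rfl⟩)
  obtain ⟨a, ha⟩ := (Finsupp.mem_span_range_iff_exists_finsupp).mp (hspan X X.2)
  refine ⟨a, Subtype.ext ?_⟩
  rw [← ha, Finsupp.linearCombination_apply]
  simp [Finsupp.sum, schur]

theorem schurFunctional_linearCombination (a : YoungDiagram →₀ ℤ) (lam : YoungDiagram) :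
    schurFunctional lam (Finsupp.linearCombination ℤ schur a : symmetricFunctions) = a lam := by
  classical
  have : ((Finsupp.linearCombination ℤ schur a : symmetricFunctions) : MvPowerSeries ℕ ℤ)
      = ∑ mu ∈ a.support, a mu • schurSeries mu := by
    rw [Finsupp.linearCombination_apply]
    simp [Finsupp.sum, schur]
  rw [this, schurFunctional_sum_schurSeries a]
  simp
  tauto

theorem schurCoeff_apply (X : symmetricFunctions) (lam : YoungDiagram) :
    schurCoeff X lam = schurFunctional lam X := by
  have h : Finsupp.linearCombination ℤ schur (schurCoeff X) = X :=
    Function.invFun_eq (exists_linearCombination_schur X)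
  rw [← schurFunctional_linearCombination, h]

theorem symmetricFunctions_le : symmetricFunctions ≤ symmetricSeries ℕ :=
  Algebra.adjoin_le (by rintro _ ⟨lam, rfl⟩; exact schurSeries_mem lam)

theorem symmetricFunctions_ext {X Y : symmetricFunctions}
    (h : ∀ lam, schurFunctional lam X = schurFunctional lam Y) : X = Y :=
  Subtype.ext (eq_of_schurFunctional_eq (symmetricFunctions_le X.2) (symmetricFunctions_le Y.2) h)

/-! ### Infinite products of power series -/

/-- Every monomial `x ^ d` has divisors occurring in only finitely many of the series `f i`. It
makes `∏ (1 + f i)` converge coefficientwise. -/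
def IsLocallyFinite {ι τ : Type*} (f : ι → MvPowerSeries τ ℤ) : Prop :=
  ∀ d : τ →₀ ℕ, {i | ∃ e ≤ d, MvPowerSeries.coeff e (f i) ≠ 0}.Finite

theorem IsLocallyFinite.comp {ι κ τ : Type*} {f : ι → MvPowerSeries τ ℤ} (hf : IsLocallyFinite f)
    {g : κ → ι} (hg : Function.Injective g) : IsLocallyFinite (f ∘ g) :=
  fun d => Set.Finite.preimage (f := g) hg.injOn (hf d)

/-- If `x ^ d` occurs in `∏_{i ∈ s} f i`, then every factor contains a divisor of `x ^ d`; so only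
finitely many `s` contribute to a given coefficient. -/
theorem IsLocallyFinite.multipliable {ι τ : Type*} {f : ι → MvPowerSeries τ ℤ}
    (hf : IsLocallyFinite f) : Multipliable fun i => 1 + f i := by
  classical
  refine multipliable_one_add_of_summable_prod ?_
  rw [MvPowerSeries.WithPiTopology.summable_iff_summable_coeff]
  intro d
  refine summable_of_hasFiniteSupport
    (((hf d).toFinset.powerset.finite_toSet).subset fun s hs => ?_)
  rw [Finset.mem_coe, Finset.mem_powerset]
  intro i hi
  rw [Set.Finite.mem_toFinset]
  by_contra h
  refine hs ?_
  simp only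
  rw [← Finset.mul_prod_erase s f hi, MvPowerSeries.coeff_mul]
  refine Finset.sum_eq_zero fun p hp => ?_
  have hle : p.1 ≤ d := by
    rw [Finset.HasAntidiagonal.mem_antidiagonal] at hp
    rw [← hp]
    exact le_self_add
  have h0 : MvPowerSeries.coeff p.1 (f i) = 0 := by
    by_contra hne
    exact h ⟨p.1, hle, hne⟩
  rw [h0, zero_mul]

theorem continuous_rename {σ τ : Type*} (e : σ → τ) [Filter.TendstoCofinite e] :
    Continuous (MvPowerSeries.rename e : MvPowerSeries σ ℤ →ₐ[ℤ] MvPowerSeries τ ℤ) := by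
  refine continuous_pi fun d => ?_
  exact continuous_finsetSum _ fun i _ => MvPowerSeries.WithPiTopology.continuous_coeff ℤ i

theorem X_mul_X_eq_monomial {τ : Type*} (a b : τ) :
    (MvPowerSeries.X a * MvPowerSeries.X b : MvPowerSeries τ ℤ) =
      MvPowerSeries.monomial (Finsupp.single a 1 + Finsupp.single b 1) 1 := by
  rw [MvPowerSeries.X_def, MvPowerSeries.X_def, MvPowerSeries.monomial_mul_monomial, one_mul]

theorem mem_support_of_coeff_X_mul_X_mul {τ : Type*} {a b : τ} {g : MvPowerSeries τ ℤ}
    {d e : τ →₀ ℕ} (hed : e ≤ d)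
    (he : MvPowerSeries.coeff e (MvPowerSeries.X a * MvPowerSeries.X b * g) ≠ 0) :
    a ∈ d.support ∧ b ∈ d.support := by
  rw [X_mul_X_eq_monomial, MvPowerSeries.coeff_monomial_mul] at he
  have hle : Finsupp.single a 1 + Finsupp.single b 1 ≤ e := by
    by_contra h
    exact he (if_neg h)
  have h1 : Finsupp.single a 1 ≤ d := le_self_add.trans (hle.trans hed)
  have h2 : Finsupp.single b 1 ≤ d := le_add_self.trans (hle.trans hed)
  rw [Finsupp.single_le_iff] at h1 h2
  rw [Finsupp.mem_support_iff, Finsupp.mem_support_iff]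
  omega

open Classical in
/-- The monomial `x_a x_b` of an unordered pair `{a, b}`, weighted by `ε` if `a = b`. -/
noncomputable def pairTerm {τ : Type*} (ε : ℤ) (z : Sym2 τ) : MvPowerSeries τ ℤ :=
  z.lift ⟨fun a b =>
      MvPowerSeries.X a * MvPowerSeries.X b * MvPowerSeries.C (if a = b then ε else 1),
    fun a b => by simp only [mul_comm (MvPowerSeries.X a), eq_comm (a := a)]⟩

open Classical in
theorem pairTerm_mk {τ : Type*} (ε : ℤ) (a b : τ) : pairTerm ε s(a, b) =
    MvPowerSeries.X a * MvPowerSeries.X b * MvPowerSeries.C (if a = b then ε else 1) := rfl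

/-- The product `∏ (1 - x_a x_b)` over all unordered pairs, where the factor of the diagonal pair
`{a, a}` is `1 - ε x_a²`: for `ε = 1` it is `∏_{a ≤ b} (1 - x_a x_b)`, for `ε = 0` it is
`∏_{a < b} (1 - x_a x_b)`. -/
noncomputable def pairProduct (τ : Type*) (ε : ℤ) : MvPowerSeries τ ℤ :=
  ∏' z : Sym2 τ, (1 + -pairTerm ε z)

theorem isLocallyFinite_pairTerm (τ : Type*) (ε : ℤ) :
    IsLocallyFinite fun z : Sym2 τ => -pairTerm ε z := by
  classical
  refine fun d => (d.support.sym2.finite_toSet).subset ?_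
  rintro z ⟨e, hed, he⟩
  induction z using Sym2.ind with
  | _ a b =>
  rw [Finset.mem_coe, Finset.mk_mem_sym2_iff]
  simp only [pairTerm_mk, mul_assoc, ← mul_neg] at he
  rw [← mul_assoc] at he
  exact mem_support_of_coeff_X_mul_X_mul hed he

theorem rename_pairTerm {σ τ : Type*} (ε : ℤ) {e : σ → τ} [Filter.TendstoCofinite e]
    (he : Function.Injective e) (z : Sym2 σ) :
    MvPowerSeries.rename e (pairTerm ε z) = pairTerm ε (z.map e) := by
  induction z using Sym2.ind with
  | _ a b =>
    rw [Sym2.map_mk, pairTerm_mk, pairTerm_mk, map_mul, map_mul, MvPowerSeries.rename_X,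
      MvPowerSeries.rename_X, MvPowerSeries.rename_C]
    by_cases h : a = b
    · rw [if_pos h, if_pos (congrArg e h)]
    · rw [if_neg h, if_neg (he.ne h)]

theorem rename_pairProduct {σ τ : Type*} (ε : ℤ) {e : σ → τ} [Filter.TendstoCofinite e]
    (he : Function.Injective e) :
    MvPowerSeries.rename e (pairProduct σ ε) = ∏' z : Sym2 σ, (1 + -pairTerm ε (z.map e)) := by
  rw [pairProduct, (isLocallyFinite_pairTerm σ ε).multipliable.map_tprod _ (continuous_rename e)]
  simp only [map_add, map_one, map_neg, rename_pairTerm ε he]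

theorem rename_equiv_pairProduct {σ τ : Type*} (ε : ℤ) (e : σ ≃ τ) :
    MvPowerSeries.rename e (pairProduct σ ε) = pairProduct τ ε := by
  rw [rename_pairProduct ε e.injective, pairProduct]
  have hb : Function.Bijective (Sym2.map e) := ⟨Sym2.map.injective e.injective, fun z =>
    ⟨z.map e.symm, by rw [Sym2.map_map, e.self_comp_symm, Sym2.map_id, id]⟩⟩
  exact Equiv.tprod_eq (Equiv.ofBijective _ hb) fun z => 1 + -pairTerm ε z

theorem pairProduct_mem (τ : Type*) (ε : ℤ) : pairProduct τ ε ∈ symmetricSeries τ :=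
  fun e => rename_equiv_pairProduct ε e

theorem sym2_sum_bijective (σ τ : Type*) : Function.Bijective
    (Sum.elim (Sum.elim (Sym2.map Sum.inl) (Sym2.map Sum.inr))
        fun p => s(Sum.inl p.1, Sum.inr p.2) :
      (Sym2 σ ⊕ Sym2 τ) ⊕ σ × τ → Sym2 (σ ⊕ τ)) := by
  constructor
  · rintro ((z | z) | ⟨a, b⟩) ((z' | z') | ⟨a', b'⟩) h
    all_goals
      try induction z using Sym2.ind
      try induction z' using Sym2.ind
      simp at h ⊢
    all_goals assumption
  · intro z
    induction z using Sym2.ind with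
    | _ a b =>
    rcases a with a | a <;> rcases b with b | b
    · exact ⟨Sum.inl (Sum.inl s(a, b)), by simp⟩
    · exact ⟨Sum.inr (a, b), by simp⟩
    · exact ⟨Sum.inr (b, a), by simp [Sym2.eq_swap]⟩
    · exact ⟨Sum.inl (Sum.inr s(a, b)), by simp⟩

theorem isLocallyFinite_X_mul_X_mul (g : ℕ × ℕ → MvPowerSeries (ℕ ⊕ ℕ) ℤ) :
    IsLocallyFinite fun p : ℕ × ℕ =>
      (MvPowerSeries.X (Sum.inl p.1) * MvPowerSeries.X (Sum.inr p.2) * g p :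
        MvPowerSeries (ℕ ⊕ ℕ) ℤ) := by
  refine fun d => (((d.support ×ˢ d.support).finite_toSet.preimage
    (f := fun p : ℕ × ℕ => ((Sum.inl p.1 : ℕ ⊕ ℕ), (Sum.inr p.2 : ℕ ⊕ ℕ))) ?_).subset ?_)
  · rintro ⟨a, b⟩ _ ⟨c, d⟩ _ h
    simpa using h
  · rintro p ⟨e, hed, he⟩
    rw [Set.mem_preimage, Finset.mem_coe, Finset.mem_product]
    exact mem_support_of_coeff_X_mul_X_mul hed he

/-- The unordered pairs in the union of two alphabets are the pairs in either alphabet and the mixed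
pairs. -/
theorem pairProduct_sum (ε : ℤ) : pairProduct (ℕ ⊕ ℕ) ε =
    MvPowerSeries.rename (Function.Embedding.inl : ℕ ↪ ℕ ⊕ ℕ) (pairProduct ℕ ε) *
      MvPowerSeries.rename (Function.Embedding.inr : ℕ ↪ ℕ ⊕ ℕ) (pairProduct ℕ ε) *
      ∏' p : ℕ × ℕ, (1 - MvPowerSeries.X (Sum.inl p.1) * MvPowerSeries.X (Sum.inr p.2)) := by
  have hl := isLocallyFinite_pairTerm (ℕ ⊕ ℕ) ε
  have hb := sym2_sum_bijective ℕ ℕ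
  have hm : ∀ {κ : Type} (g : κ → (Sym2 ℕ ⊕ Sym2 ℕ) ⊕ ℕ × ℕ) (_ : Function.Injective g),
      Multipliable fun i => 1 + -pairTerm ε (Equiv.ofBijective _ hb (g i)) :=
    fun g hg => (hl.comp (hb.injective.comp hg)).multipliable
  rw [rename_pairProduct ε Function.Embedding.inl.injective,
    rename_pairProduct ε Function.Embedding.inr.injective, pairProduct,
    ← (Equiv.ofBijective _ hb).tprod_eq, Multipliable.tprod_sum, Multipliable.tprod_sum]
  · congr 1
    refine tprod_congr fun p => ?_
    simp [pairTerm_mk, sub_eq_add_neg]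
  · exact hm (fun i => Sum.inl (Sum.inl i)) (Sum.inl_injective.comp Sum.inl_injective)
  · exact hm (fun i => Sum.inl (Sum.inr i)) (Sum.inl_injective.comp Sum.inr_injective)
  · exact hm Sum.inl Sum.inl_injective
  · exact hm Sum.inr Sum.inr_injective

theorem one_sub_mul_invOfUnit (p : ℕ × ℕ) :
    (1 - MvPowerSeries.X (Sum.inl p.1) * MvPowerSeries.X (Sum.inr p.2)) *
      MvPowerSeries.invOfUnit
        (1 - MvPowerSeries.X (Sum.inl p.1) * MvPowerSeries.X (Sum.inr p.2) :
          MvPowerSeries (ℕ ⊕ ℕ) ℤ) 1 = 1 :=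
  MvPowerSeries.mul_invOfUnit _ _ (by simp)

theorem invOfUnit_eq_one_add (p : ℕ × ℕ) :
    MvPowerSeries.invOfUnit
        (1 - MvPowerSeries.X (Sum.inl p.1) * MvPowerSeries.X (Sum.inr p.2) :
          MvPowerSeries (ℕ ⊕ ℕ) ℤ) 1 =
      1 + MvPowerSeries.X (Sum.inl p.1) * MvPowerSeries.X (Sum.inr p.2) *
        MvPowerSeries.invOfUnit
          (1 - MvPowerSeries.X (Sum.inl p.1) * MvPowerSeries.X (Sum.inr p.2)) 1 := by
  have := one_sub_mul_invOfUnit p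
  rw [sub_mul, one_mul] at this
  rw [← sub_eq_iff_eq_add, this]

theorem multipliable_cauchyKernel : Multipliable fun p : ℕ × ℕ => MvPowerSeries.invOfUnit
    (1 - MvPowerSeries.X (Sum.inl p.1) * MvPowerSeries.X (Sum.inr p.2) :
      MvPowerSeries (ℕ ⊕ ℕ) ℤ) 1 := by
  have h := (isLocallyFinite_X_mul_X_mul fun p => MvPowerSeries.invOfUnit
          (1 - MvPowerSeries.X (Sum.inl p.1) * MvPowerSeries.X (Sum.inr p.2)) 1).multipliable
  exact h.congr fun p => (invOfUnit_eq_one_add p).symm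

theorem multipliable_one_sub : Multipliable fun p : ℕ × ℕ =>
    (1 - MvPowerSeries.X (Sum.inl p.1) * MvPowerSeries.X (Sum.inr p.2) :
      MvPowerSeries (ℕ ⊕ ℕ) ℤ) :=
  (isLocallyFinite_X_mul_X_mul fun _ => -1).multipliable.congr fun p => by ring

theorem tprod_one_sub_mul_cauchyKernel :
    (∏' p : ℕ × ℕ, (1 - MvPowerSeries.X (Sum.inl p.1) * MvPowerSeries.X (Sum.inr p.2))) *
      cauchyKernel = 1 := by
  rw [cauchyKernel, ← multipliable_one_sub.tprod_mul multipliable_cauchyKernel]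
  simp only [one_sub_mul_invOfUnit, tprod_one]

theorem pairProduct_sum_mul_cauchyKernel (ε : ℤ) : pairProduct (ℕ ⊕ ℕ) ε * cauchyKernel =
    MvPowerSeries.rename (Function.Embedding.inl : ℕ ↪ ℕ ⊕ ℕ) (pairProduct ℕ ε) *
      MvPowerSeries.rename (Function.Embedding.inr : ℕ ↪ ℕ ⊕ ℕ) (pairProduct ℕ ε) := by
  rw [pairProduct_sum, mul_assoc, tprod_one_sub_mul_cauchyKernel, mul_one]

theorem rename_swap_cauchyKernel :
    MvPowerSeries.rename (Equiv.sumComm ℕ ℕ) cauchyKernel = cauchyKernel := by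
  have h : (MvPowerSeries.rename (Equiv.sumComm ℕ ℕ) (∏' p : ℕ × ℕ,
        (1 - MvPowerSeries.X (Sum.inl p.1) * MvPowerSeries.X (Sum.inr p.2))) :
        MvPowerSeries (ℕ ⊕ ℕ) ℤ) =
      ∏' p : ℕ × ℕ, (1 - MvPowerSeries.X (Sum.inl p.1) * MvPowerSeries.X (Sum.inr p.2)) := by
    rw [multipliable_one_sub.map_tprod _ (continuous_rename _), ← (Equiv.prodComm ℕ ℕ).tprod_eq]
    refine tprod_congr fun p => ?_
    simp [mul_comm]
  have h1 := congrArg (MvPowerSeries.rename (Equiv.sumComm ℕ ℕ)) tprod_one_sub_mul_cauchyKernel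
  rw [map_mul, h, map_one] at h1
  exact (inv_unique tprod_one_sub_mul_cauchyKernel h1).symm

theorem productLE_eq : productLE =
    MvPowerSeries.rename (Function.Embedding.inr : ℕ ↪ ℕ ⊕ ℕ) (pairProduct ℕ 1) := by
  rw [rename_pairProduct 1 Function.Embedding.inr.injective, productLE]
  have hinj : Function.Injective fun p : {p : ℕ × ℕ // p.1 ≤ p.2} => s(p.1.1, p.1.2) := by
    rintro ⟨⟨a, b⟩, hp⟩ ⟨⟨c, d⟩, hq⟩ h
    simp at h hp hq ⊢
    omega
  rw [← hinj.tprod_eq]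
  · refine tprod_congr fun p => ?_
    simp [pairTerm_mk, sub_eq_add_neg]
  · intro z _
    induction z using Sym2.ind with
    | _ a b =>
    rcases le_total a b with h | h
    · exact ⟨⟨(a, b), h⟩, rfl⟩
    · exact ⟨⟨(b, a), h⟩, Sym2.eq_swap⟩

theorem productLT_eq : productLT =
    MvPowerSeries.rename (Function.Embedding.inr : ℕ ↪ ℕ ⊕ ℕ) (pairProduct ℕ 0) := by
  rw [rename_pairProduct 0 Function.Embedding.inr.injective, productLT]
  have hinj : Function.Injective fun p : {p : ℕ × ℕ // p.1 < p.2} => s(p.1.1, p.1.2) := by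
    rintro ⟨⟨a, b⟩, hp⟩ ⟨⟨c, d⟩, hq⟩ h
    simp at h hp hq ⊢
    omega
  rw [← hinj.tprod_eq]
  · refine tprod_congr fun p => ?_
    simp [pairTerm_mk, sub_eq_add_neg, p.2.ne]
  · intro z hz
    induction z using Sym2.ind with
    | _ a b =>
    rcases lt_trichotomy a b with h | h | h
    · exact ⟨⟨(a, b), h⟩, rfl⟩
    · exact absurd (by simp [pairTerm_mk, h]) hz
    · exact ⟨⟨(b, a), h⟩, Sym2.eq_swap⟩

/-! ### The coefficients of the Cauchy kernel -/

theorem coeff_sumElim_mul (f g : MvPowerSeries (ℕ ⊕ ℕ) ℤ) (m b : ℕ →₀ ℕ) :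
    MvPowerSeries.coeff (m.sumElim b) (f * g) =
      ∑ p ∈ Finset.HasAntidiagonal.antidiagonal m, ∑ q ∈ Finset.HasAntidiagonal.antidiagonal b,
        MvPowerSeries.coeff (p.1.sumElim q.1) f * MvPowerSeries.coeff (p.2.sumElim q.2) g := by
  classical
  rw [MvPowerSeries.coeff_mul, ← Finsupp.image_sumElim_product_antidiagonal, Finset.sum_image,
    Finset.sum_product]
  rintro ⟨⟨a, b⟩, c, d⟩ _ ⟨⟨a', b'⟩, c', d'⟩ _ h
  have hinj : ∀ {x y x' y' : ℕ →₀ ℕ}, x.sumElim y = x'.sumElim y' → x = x' ∧ y = y' := by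
    intro x y x' y' h
    have := Finsupp.sumFinsuppEquivProdFinsupp.symm.injective (a₁ := (x, y)) (a₂ := (x', y')) h
    simpa using this
  simp only [Prod.mk.injEq] at h ⊢
  exact ⟨⟨(hinj h.1).1, (hinj h.2).1⟩, (hinj h.1).2, (hinj h.2).2⟩

theorem exists_sumElim (e : ℕ ⊕ ℕ →₀ ℕ) : ∃ m b : ℕ →₀ ℕ, m.sumElim b = e :=
  ⟨_, _, Finsupp.comapDomain_sumElim_comapDomain e⟩

theorem sumElim_le_sumElim {m b m' b' : ℕ →₀ ℕ} :
    m.sumElim b ≤ m'.sumElim b' ↔ m ≤ m' ∧ b ≤ b' := by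
  simp [Finsupp.le_def]

theorem sumElim_tsub (m b m' b' : ℕ →₀ ℕ) :
    m.sumElim b - m'.sumElim b' = (m - m').sumElim (b - b') := by
  ext (i | i) <;> simp

open Classical in
/-- The product of the factors `(1 - x_i y_j)⁻¹` with `i < N` and `j` fixed, given by its
coefficients: it is the sum of `x ^ m y_j ^ |m|` over the monomials `x ^ m` in the first `N`
indeterminates. -/
noncomputable def columnSeries (N j : ℕ) : MvPowerSeries (ℕ ⊕ ℕ) ℤ := fun e =>
  if (∀ i ≥ N, e (Sum.inl i) = 0) ∧ e.comapDomain Sum.inr Sum.inr_injective.injOn =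
    Finsupp.single j (e.comapDomain Sum.inl Sum.inl_injective.injOn).degree then 1 else 0

open Classical in
theorem coeff_columnSeries (N j : ℕ) (m b : ℕ →₀ ℕ) :
    MvPowerSeries.coeff (m.sumElim b) (columnSeries N j) =
      if (∀ i ≥ N, m i = 0) ∧ b = Finsupp.single j m.degree then 1 else 0 := by
  change (if _ then _ else _) = _
  simp

theorem columnSeries_zero (j : ℕ) : columnSeries 0 j = 1 := by
  classical
  ext e
  obtain ⟨m, b, rfl⟩ := exists_sumElim e
  rw [coeff_columnSeries, MvPowerSeries.coeff_one]
  congr 1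
  rw [eq_iff_iff]
  constructor
  · rintro ⟨h1, h2⟩
    have : m = 0 := Finsupp.ext fun i => h1 i (Nat.zero_le i)
    simp [h2, this]
  · intro h
    have h1 : m = 0 := Finsupp.ext fun i => by simpa using DFunLike.congr_fun h (Sum.inl i)
    have h2 : b = 0 := Finsupp.ext fun i => by simpa using DFunLike.congr_fun h (Sum.inr i)
    simp [h1, h2]

open Classical in
/-- The recursion that identifies `columnSeries` with a product. It says that a monomial `x ^ m` in
the first `N + 1` indeterminates is either free of `x_N` or divisible by it. -/
theorem one_sub_mul_columnSeries (N j : ℕ) :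
    (1 - MvPowerSeries.X (Sum.inl N) * MvPowerSeries.X (Sum.inr j)) * columnSeries (N + 1) j =
      columnSeries N j := by
  ext e
  obtain ⟨m, b, rfl⟩ := exists_sumElim e
  rw [sub_mul, one_mul, X_mul_X_eq_monomial, ← Finsupp.sumElim_single_single, map_sub,
    MvPowerSeries.coeff_monomial_mul, sumElim_tsub, coeff_columnSeries, coeff_columnSeries,
    coeff_columnSeries]
  simp only [sumElim_le_sumElim, Finsupp.single_le_iff]
  by_cases hm : m N = 0
  · have h1 : (∀ i ≥ N + 1, m i = 0) ↔ ∀ i ≥ N, m i = 0 := by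
      refine ⟨fun h i hi => ?_, fun h i hi => h i (by omega)⟩
      rcases Nat.eq_or_lt_of_le hi with rfl | hi
      · exact hm
      · exact h i hi
    rw [if_neg (c := 1 ≤ m N ∧ 1 ≤ b j) (by simp [hm]), sub_zero]
    exact if_congr (and_congr_left fun _ => h1) rfl rfl
  · have h1 : ¬ ∀ i ≥ N, m i = 0 := fun h => hm (h N le_rfl)
    obtain ⟨m', rfl⟩ : ∃ m' : ℕ →₀ ℕ, m = Finsupp.single N 1 + m' :=
      exists_add_of_le (Finsupp.single_le_iff.mpr (Nat.pos_of_ne_zero hm))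
    have h2 : (∀ i ≥ N + 1, (Finsupp.single N 1 + m' : ℕ →₀ ℕ) i = 0) ↔ ∀ i ≥ N + 1, m' i = 0 := by
      refine forall₂_congr fun i hi => ?_
      rw [Finsupp.add_apply, Finsupp.single_eq_of_ne (by omega), zero_add]
    have h3 : (b = Finsupp.single j (Finsupp.single N 1 + m' : ℕ →₀ ℕ).degree) ↔
        1 ≤ b j ∧ b - Finsupp.single j 1 = Finsupp.single j m'.degree := by
      rw [map_add, Finsupp.degree_single, Finsupp.single_add]
      constructor
      · rintro rfl
        simp
      · rintro ⟨h, h'⟩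
        rw [← h', add_tsub_cancel_of_le (Finsupp.single_le_iff.mpr h)]
    rw [if_neg (show ¬ ((∀ i ≥ N, _ = _) ∧ _) from fun h => h1 h.1)]
    have h5 : 1 ≤ (Finsupp.single N 1 + m' : ℕ →₀ ℕ) N := by simp
    by_cases h4 : 1 ≤ b j
    · rw [if_pos (c := 1 ≤ (Finsupp.single N 1 + m' : ℕ →₀ ℕ) N ∧ 1 ≤ b j) ⟨h5, h4⟩, one_mul,
        sub_eq_zero]
      refine if_congr ?_ rfl rfl
      rw [add_tsub_cancel_left, h2, h3]
      exact and_congr_right fun _ => and_iff_right h4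
    · rw [if_neg (c := 1 ≤ (Finsupp.single N 1 + m' : ℕ →₀ ℕ) N ∧ 1 ≤ b j) fun h => h4 h.2,
        sub_zero]
      exact if_neg fun h => h4 (h3.mp h.2).1

theorem prod_range_invOfUnit (N j : ℕ) :
    ∏ i ∈ Finset.range N, MvPowerSeries.invOfUnit
      (1 - MvPowerSeries.X (Sum.inl i) * MvPowerSeries.X (Sum.inr j) : MvPowerSeries (ℕ ⊕ ℕ) ℤ) 1 =
      columnSeries N j := by
  induction N with
  | zero => rw [Finset.prod_range_zero, columnSeries_zero]
  | succ N ih =>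
    rw [Finset.prod_range_succ, ih, ← one_sub_mul_columnSeries, mul_comm, ← mul_assoc,
      mul_comm _ (1 - _), one_sub_mul_invOfUnit (N, j), one_mul]

theorem hsymmProd_erase_mul (b : ℕ →₀ ℕ) (j : ℕ) :
    hsymmProd (b.erase j) * hsymmSeries ℕ (b j) = hsymmProd b := by
  rw [mul_comm]
  exact Finsupp.mul_prod_erase' b j _ fun _ => hsymmSeries_zero ℕ

open Classical in
/-- The condition on `m` lets the coefficient be computed as if the first alphabet were infinite. -/
theorem coeff_prod_columnSeries (N k : ℕ) {m : ℕ →₀ ℕ} (hm : ∀ i ≥ N, m i = 0) (b : ℕ →₀ ℕ) :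
    MvPowerSeries.coeff (m.sumElim b) (∏ j ∈ Finset.range k, columnSeries N j) =
      if ∀ j ≥ k, b j = 0 then MvPowerSeries.coeff m (hsymmProd b) else 0 := by
  induction k generalizing m b with
  | zero =>
    have h1 : (∀ j ≥ 0, b j = 0) ↔ b = 0 := by simp [Finsupp.ext_iff]
    have h2 : m.sumElim b = 0 ↔ m = 0 ∧ b = 0 := by simp [Finsupp.ext_iff]
    simp only [Finset.prod_range_zero, MvPowerSeries.coeff_one, h1, h2]
    by_cases hb : b = 0
    · simp [hb, hsymmProd, MvPowerSeries.coeff_one]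
    · simp [hb]
  | succ k ih =>
    rw [Finset.prod_range_succ, coeff_sumElim_mul]
    have hle : ∀ p ∈ Finset.HasAntidiagonal.antidiagonal m,
        (∀ i ≥ N, p.1 i = 0) ∧ ∀ i ≥ N, p.2 i = 0 := by
      intro p hp
      rw [Finset.HasAntidiagonal.mem_antidiagonal] at hp
      refine ⟨fun i hi => ?_, fun i hi => ?_⟩ <;>
      · have := hm i hi
        rw [← hp, Finsupp.add_apply] at this
        omega
    -- The last column must take its whole exponent `b k` from `b`, so one pair `q` contributes.
    have hterm : ∀ p ∈ Finset.HasAntidiagonal.antidiagonal m,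
        ∑ q ∈ Finset.HasAntidiagonal.antidiagonal b,
        MvPowerSeries.coeff (p.1.sumElim q.1) (∏ j ∈ Finset.range k, columnSeries N j) *
          MvPowerSeries.coeff (p.2.sumElim q.2) (columnSeries N k) =
        if ∀ j ≥ k + 1, b j = 0 then MvPowerSeries.coeff p.1 (hsymmProd (b.erase k)) *
          MvPowerSeries.coeff p.2 (hsymmSeries ℕ (b k)) else 0 := by
      intro p hp
      rw [Finset.sum_eq_single (b.erase k, Finsupp.single k (b k))]
      · have h1 : (∀ j ≥ k, b.erase k j = 0) ↔ ∀ j ≥ k + 1, b j = 0 := by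
          refine ⟨fun h j hj => ?_, fun h j hj => ?_⟩
          · rw [← Finsupp.erase_ne (show j ≠ k by omega)]
            exact h j (by omega)
          · rcases Nat.eq_or_lt_of_le hj with rfl | hj
            · exact Finsupp.erase_same
            · rw [Finsupp.erase_ne (by omega)]
              exact h j hj
        rw [ih (hle p hp).1, coeff_columnSeries, coeff_hsymmSeries]
        have h2 := (hle p hp).2
        simp only [h1, (Finsupp.single_injective k).eq_iff, eq_comm (a := b k)]
        split_ifs <;> simp_all
      · intro q hq hne
        rw [Finset.HasAntidiagonal.mem_antidiagonal] at hq
        rw [ih (hle p hp).1, coeff_columnSeries]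
        by_contra h
        apply hne
        have h1 : ∀ j ≥ k, q.1 j = 0 := by
          by_contra h1
          exact h (by rw [if_neg h1, zero_mul])
        have h2 : q.2 = Finsupp.single k p.2.degree := by
          by_contra h2
          exact h (by simp only [h2, and_false, if_false, mul_zero])
        have h3 : b k = p.2.degree := by
          rw [← hq, Finsupp.add_apply, h1 k le_rfl, h2]
          simp
        refine Prod.ext (Finsupp.ext fun j => ?_) (by rw [h2, h3])
        by_cases hj : j = k
        · subst hj
          simp [h1 j le_rfl]
        · simp only
          rw [Finsupp.erase_ne hj, ← hq, Finsupp.add_apply, h2, Finsupp.single_eq_of_ne hj,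
            add_zero]
      · intro h
        refine absurd ?_ h
        rw [Finset.HasAntidiagonal.mem_antidiagonal, add_comm]
        exact Finsupp.single_add_erase k b
    rw [Finset.sum_congr rfl hterm]
    by_cases hb : ∀ j ≥ k + 1, b j = 0
    · classical
      rw [if_pos hb, ← hsymmProd_erase_mul b k, MvPowerSeries.coeff_mul]
      simp only [if_pos hb]
    · simp only [if_neg hb, Finset.sum_const_zero]

/-- The expansion `∏ (1 - x_i y_a)⁻¹ = ∑_b h_b(x) y ^ b`. -/
theorem coeff_cauchyKernel (m b : ℕ →₀ ℕ) :
    MvPowerSeries.coeff (m.sumElim b) cauchyKernel = MvPowerSeries.coeff m (hsymmProd b) := by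
  have h := ((MvPowerSeries.WithPiTopology.continuous_coeff ℤ (m.sumElim b)).tendsto _).comp
    multipliable_cauchyKernel.hasProd
  rw [nhds_discrete, Filter.tendsto_pure] at h
  obtain ⟨s, hs⟩ := Filter.eventually_atTop.mp h
  -- The finite subproduct over `s` is enlarged to a square that covers the supports of `m`, `b`.
  obtain ⟨N, hN⟩ : ∃ N, ∀ x ∈ m.support ∪ b.support ∪ s.image Prod.fst ∪ s.image Prod.snd, x < N :=
    ⟨_, fun x hx => Nat.lt_succ_of_le (Finset.le_sup (f := id) hx)⟩
  have hsub : s ⊆ Finset.range N ×ˢ Finset.range N := by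
    intro p hp
    rw [Finset.mem_product, Finset.mem_range, Finset.mem_range]
    have h1 := Finset.mem_image_of_mem Prod.fst hp
    have h2 := Finset.mem_image_of_mem Prod.snd hp
    exact ⟨hN _ (by simp only [Finset.mem_union]; tauto),
      hN _ (by simp only [Finset.mem_union]; tauto)⟩
  have hm : ∀ i ≥ N, m i = 0 := by
    intro i hi
    by_contra hne
    have := hN i (by simp [hne])
    omega
  have hb : ∀ i ≥ N, b i = 0 := by
    intro i hi
    by_contra hne
    have := hN i (by simp [hne])
    omega
  have := hs _ hsub
  simp only [Function.comp_apply, Finset.prod_product_right, prod_range_invOfUnit] at this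
  rw [cauchyKernel, ← this, coeff_prod_columnSeries N N hm, if_pos hb]

/-- Both sides count the matrices of natural numbers with row sums `m` and column sums `b`;
formally, the Cauchy kernel is invariant under exchanging the alphabets. -/
theorem coeff_hsymmProd_comm (m b : ℕ →₀ ℕ) :
    MvPowerSeries.coeff m (hsymmProd b) = MvPowerSeries.coeff b (hsymmProd m) := by
  rw [← coeff_cauchyKernel, ← coeff_cauchyKernel, ← rename_swap_cauchyKernel]
  have := coeff_embDomain_equiv (Equiv.sumComm ℕ ℕ) cauchyKernel (b.sumElim m)
  rw [rename_swap_cauchyKernel] at this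
  rw [rename_swap_cauchyKernel, ← this]
  congr 2
  rw [Finsupp.embDomain_eq_mapDomain]
  exact (Finsupp.mapDomain_swap_sumElim b m).symm

/-! ### Series in two alphabets -/

/-- The coefficient of `x ^ m` of a series in two alphabets, a series in the second alphabet. -/
noncomputable def slice (m : ℕ →₀ ℕ) : MvPowerSeries (ℕ ⊕ ℕ) ℤ →ₗ[ℤ] MvPowerSeries ℕ ℤ where
  toFun F := fun b => MvPowerSeries.coeff (m.sumElim b) F
  map_add' F G := by ext b; exact map_add (MvPowerSeries.coeff (m.sumElim b)) F G
  map_smul' c F := by ext b; exact map_smul (MvPowerSeries.coeff (m.sumElim b)) c F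

theorem coeff_slice (m b : ℕ →₀ ℕ) (F : MvPowerSeries (ℕ ⊕ ℕ) ℤ) :
    MvPowerSeries.coeff b (slice m F) = MvPowerSeries.coeff (m.sumElim b) F := rfl

/-- The coefficient functional of `s_μ` applied in the second alphabet. -/
noncomputable def partialSchurFunctional (mu : YoungDiagram) :
    MvPowerSeries (ℕ ⊕ ℕ) ℤ →ₗ[ℤ] MvPowerSeries ℕ ℤ where
  toFun F := fun m => schurFunctional mu (slice m F)
  map_add' F G := by ext m; exact map_add (schurFunctional mu ∘ₗ slice m) F G
  map_smul' c F := by ext m; exact map_smul (schurFunctional mu ∘ₗ slice m) c F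

theorem coeff_partialSchurFunctional (mu : YoungDiagram) (F : MvPowerSeries (ℕ ⊕ ℕ) ℤ)
    (m : ℕ →₀ ℕ) : MvPowerSeries.coeff m (partialSchurFunctional mu F) =
      schurFunctional mu (slice m F) := rfl

/-- The functional that extracts the coefficient of `s_λ(x) s_μ(y)`. -/
noncomputable def biSchurFunctional (lam mu : YoungDiagram) : MvPowerSeries (ℕ ⊕ ℕ) ℤ →ₗ[ℤ] ℤ :=
  schurFunctional lam ∘ₗ partialSchurFunctional mu

theorem biSchurFunctional_apply (lam mu : YoungDiagram) (F : MvPowerSeries (ℕ ⊕ ℕ) ℤ) :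
    biSchurFunctional lam mu F = schurFunctional lam (partialSchurFunctional mu F) := rfl

theorem biSchurFunctional_congr {lam mu : YoungDiagram} {F G : MvPowerSeries (ℕ ⊕ ℕ) ℤ}
    (h : ∀ m b : ℕ →₀ ℕ, m.degree = lam.card → b.degree = mu.card →
      MvPowerSeries.coeff (m.sumElim b) F = MvPowerSeries.coeff (m.sumElim b) G) :
    biSchurFunctional lam mu F = biSchurFunctional lam mu G :=
  schurFunctional_congr fun m hm => schurFunctional_congr fun b hb => h m b hm hb

theorem coeff_rename_inl (f : MvPowerSeries ℕ ℤ) (m b : ℕ →₀ ℕ) [Decidable (b = 0)] :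
    MvPowerSeries.coeff (m.sumElim b) (MvPowerSeries.rename (Function.Embedding.inl : ℕ ↪ ℕ ⊕ ℕ) f)
      = if b = 0 then MvPowerSeries.coeff m f else 0 := by
  split_ifs with h
  · rw [h, ← MvPowerSeries.coeff_embDomain_rename Function.Embedding.inl f m]
    congr 2
    ext (i | i)
    · exact (Finsupp.embDomain_apply_self Function.Embedding.inl m i).symm
    · exact (Finsupp.embDomain_of_notMem_range Function.Embedding.inl m (Sum.inr i) (by simp)).symm
  · apply MvPowerSeries.coeff_rename_eq_zero
    rintro ⟨x, hx⟩
    refine h (Finsupp.ext fun i => ?_)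
    have := DFunLike.congr_fun hx (Sum.inr i)
    rw [← Finsupp.embDomain_eq_mapDomain, Finsupp.embDomain_of_notMem_range _ _ _ (by simp)] at this
    exact this.symm

theorem coeff_rename_inr (f : MvPowerSeries ℕ ℤ) (m b : ℕ →₀ ℕ) [Decidable (m = 0)] :
    MvPowerSeries.coeff (m.sumElim b) (MvPowerSeries.rename (Function.Embedding.inr : ℕ ↪ ℕ ⊕ ℕ) f)
      = if m = 0 then MvPowerSeries.coeff b f else 0 := by
  split_ifs with h
  · rw [h, ← MvPowerSeries.coeff_embDomain_rename Function.Embedding.inr f b]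
    congr 2
    ext (i | i)
    · exact (Finsupp.embDomain_of_notMem_range Function.Embedding.inr b (Sum.inl i) (by simp)).symm
    · exact (Finsupp.embDomain_apply_self Function.Embedding.inr b i).symm
  · apply MvPowerSeries.coeff_rename_eq_zero
    rintro ⟨x, hx⟩
    refine h (Finsupp.ext fun i => ?_)
    have := DFunLike.congr_fun hx (Sum.inl i)
    rw [← Finsupp.embDomain_eq_mapDomain, Finsupp.embDomain_of_notMem_range _ _ _ (by simp)] at this
    exact this.symm

theorem slice_mul_rename_inr (m : ℕ →₀ ℕ) (F : MvPowerSeries (ℕ ⊕ ℕ) ℤ) (g : MvPowerSeries ℕ ℤ) :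
    slice m (F * MvPowerSeries.rename (Function.Embedding.inr : ℕ ↪ ℕ ⊕ ℕ) g) = slice m F * g := by
  classical
  ext b
  rw [coeff_slice, coeff_sumElim_mul, Finset.sum_eq_single (m, 0), MvPowerSeries.coeff_mul]
  · refine Finset.sum_congr rfl fun q _ => ?_
    rw [coeff_rename_inr, if_pos rfl, coeff_slice]
  · intro p hp hne
    refine Finset.sum_eq_zero fun q _ => ?_
    rw [coeff_rename_inr, if_neg, mul_zero]
    intro h0
    rw [Finset.HasAntidiagonal.mem_antidiagonal] at hp
    exact hne (Prod.ext (by rw [← hp, h0, add_zero]) h0)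
  · intro h
    exact absurd (by rw [Finset.HasAntidiagonal.mem_antidiagonal, add_zero]) h

theorem slice_rename_inl_mul (m : ℕ →₀ ℕ) (f g : MvPowerSeries ℕ ℤ) :
    slice m (MvPowerSeries.rename (Function.Embedding.inl : ℕ ↪ ℕ ⊕ ℕ) f *
      MvPowerSeries.rename (Function.Embedding.inr : ℕ ↪ ℕ ⊕ ℕ) g) =
      MvPowerSeries.coeff m f • g := by
  classical
  have h : slice m (MvPowerSeries.rename (Function.Embedding.inl : ℕ ↪ ℕ ⊕ ℕ) f) =
      MvPowerSeries.C (MvPowerSeries.coeff m f) := by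
    ext b
    rw [coeff_slice, coeff_rename_inl, MvPowerSeries.coeff_C]
  rw [slice_mul_rename_inr, h]
  ext b
  rw [MvPowerSeries.coeff_C_mul]
  exact (map_smul (MvPowerSeries.coeff b) _ _).symm

theorem partialSchurFunctional_rename_inl_mul (mu : YoungDiagram) (f g : MvPowerSeries ℕ ℤ) :
    partialSchurFunctional mu (MvPowerSeries.rename (Function.Embedding.inl : ℕ ↪ ℕ ⊕ ℕ) f *
      MvPowerSeries.rename (Function.Embedding.inr : ℕ ↪ ℕ ⊕ ℕ) g) = schurFunctional mu g • f := by
  ext m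
  rw [coeff_partialSchurFunctional, slice_rename_inl_mul, map_smul, smul_eq_mul, mul_comm]
  exact (map_smul (MvPowerSeries.coeff m) (schurFunctional mu g) f).symm

theorem biSchurFunctional_rename_inl_mul (lam mu : YoungDiagram) (f g : MvPowerSeries ℕ ℤ) :
    biSchurFunctional lam mu (MvPowerSeries.rename (Function.Embedding.inl : ℕ ↪ ℕ ⊕ ℕ) f *
      MvPowerSeries.rename (Function.Embedding.inr : ℕ ↪ ℕ ⊕ ℕ) g) =
      schurFunctional lam f * schurFunctional mu g := by
  rw [biSchurFunctional_apply, partialSchurFunctional_rename_inl_mul, map_smul, smul_eq_mul,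
    mul_comm]

/-! ### Products of symmetric series under the coefficient functionals -/

/-- In a product `f g` a symmetric factor `f` may be replaced by its Schur expansion, also when `g`
is not symmetric. -/
theorem schurFunctional_mul {f : MvPowerSeries ℕ ℤ} (hf : f ∈ symmetricSeries ℕ)
    (g : MvPowerSeries ℕ ℤ) (lam : YoungDiagram) :
    schurFunctional lam (f * g) = ∑ kap ∈ partitionsLE lam.card,
      schurFunctional kap f * schurFunctional lam (schurSeries kap * g) := by
  classical
  have h : ∀ kap, schurFunctional kap f * schurFunctional lam (schurSeries kap * g) =
      schurFunctional lam (schurFunctional kap f • (schurSeries kap * g)) := fun kap => by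
    rw [map_smul, smul_eq_mul]
  simp only [h]
  rw [← map_sum]
  refine schurFunctional_congr fun b hb => ?_
  rw [map_sum, MvPowerSeries.coeff_mul]
  have h2 : ∀ kap, MvPowerSeries.coeff b (schurFunctional kap f • (schurSeries kap * g)) =
      ∑ p ∈ Finset.HasAntidiagonal.antidiagonal b,
        schurFunctional kap f * MvPowerSeries.coeff p.1 (schurSeries kap) *
          MvPowerSeries.coeff p.2 g := by
    intro kap
    refine (map_smul (MvPowerSeries.coeff b) _ _).trans ?_
    rw [MvPowerSeries.coeff_mul, smul_eq_mul, Finset.mul_sum]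
    exact Finset.sum_congr rfl fun p _ => (mul_assoc _ _ _).symm
  simp only [h2]
  rw [Finset.sum_comm]
  refine Finset.sum_congr rfl fun p hp => ?_
  rw [Finset.HasAntidiagonal.mem_antidiagonal] at hp
  rw [← Finset.sum_mul, ← coeff_eq_sum_schurFunctional hf]
  rw [← hb, ← hp, map_add]
  exact Nat.le_add_right _ _

theorem schurFunctional_schurSeries_mul_eq_zero {lam kap : YoungDiagram} (h : lam.card < kap.card)
    (g : MvPowerSeries ℕ ℤ) : schurFunctional lam (schurSeries kap * g) = 0 := by
  classical
  rw [← map_zero (schurFunctional lam)]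
  refine schurFunctional_congr fun b hb => ?_
  rw [MvPowerSeries.coeff_mul, map_zero]
  refine Finset.sum_eq_zero fun p hp => ?_
  rw [Finset.HasAntidiagonal.mem_antidiagonal] at hp
  rw [isHomogeneousSeries_schurSeries kap p.1, zero_mul]
  rw [← hp, map_add] at hb
  omega

/-- The series is symmetric in each alphabet, expressed through its coefficients: those of the
monomials `x ^ m`, and then the coefficients of the Schur functions `s_μ(y)`. -/
structure IsBisymmetric (F : MvPowerSeries (ℕ ⊕ ℕ) ℤ) : Prop where
  slice_mem : ∀ m, slice m F ∈ symmetricSeries ℕ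
  partial_mem : ∀ mu, partialSchurFunctional mu F ∈ symmetricSeries ℕ

theorem IsBisymmetric.coeff_eq {F : MvPowerSeries (ℕ ⊕ ℕ) ℤ} (hF : IsBisymmetric F) {d d' : ℕ}
    {m b : ℕ →₀ ℕ} (hm : m.degree ≤ d) (hb : b.degree ≤ d') :
    MvPowerSeries.coeff (m.sumElim b) F = ∑ kap ∈ partitionsLE d, ∑ tau ∈ partitionsLE d',
      biSchurFunctional kap tau F *
        (MvPowerSeries.coeff m (schurSeries kap) * MvPowerSeries.coeff b (schurSeries tau)) := by
  rw [← coeff_slice, coeff_eq_sum_schurFunctional (hF.slice_mem m) hb, Finset.sum_comm]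
  refine Finset.sum_congr rfl fun tau _ => ?_
  rw [← coeff_partialSchurFunctional, coeff_eq_sum_schurFunctional (hF.partial_mem tau) hm,
    Finset.sum_mul]
  exact Finset.sum_congr rfl fun kap _ => mul_assoc _ _ _

/-- In a product `F G` the factor `F` may be replaced by its expansion in the products
`s_κ(x) s_τ(y)`. -/
theorem IsBisymmetric.biSchurFunctional_mul {F : MvPowerSeries (ℕ ⊕ ℕ) ℤ} (hF : IsBisymmetric F)
    (G : MvPowerSeries (ℕ ⊕ ℕ) ℤ) (lam mu : YoungDiagram) :
    biSchurFunctional lam mu (F * G) = ∑ kap ∈ partitionsLE lam.card, ∑ tau ∈ partitionsLE mu.card,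
      biSchurFunctional kap tau F * biSchurFunctional lam mu
        (MvPowerSeries.rename (Function.Embedding.inl : ℕ ↪ ℕ ⊕ ℕ) (schurSeries kap) *
          MvPowerSeries.rename (Function.Embedding.inr : ℕ ↪ ℕ ⊕ ℕ) (schurSeries tau) * G) := by
  have h : biSchurFunctional lam mu (F * G) = biSchurFunctional lam mu
      ((∑ kap ∈ partitionsLE lam.card, ∑ tau ∈ partitionsLE mu.card, biSchurFunctional kap tau F •
        (MvPowerSeries.rename (Function.Embedding.inl : ℕ ↪ ℕ ⊕ ℕ) (schurSeries kap) *
          MvPowerSeries.rename (Function.Embedding.inr : ℕ ↪ ℕ ⊕ ℕ) (schurSeries tau))) * G) := by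
    refine biSchurFunctional_congr fun m b hm hb => ?_
    rw [coeff_sumElim_mul, coeff_sumElim_mul]
    refine Finset.sum_congr rfl fun p hp => Finset.sum_congr rfl fun q hq => ?_
    rw [Finset.HasAntidiagonal.mem_antidiagonal] at hp hq
    congr 1
    rw [hF.coeff_eq (d := lam.card) (d' := mu.card)
      (by rw [← hm, ← hp, map_add]; exact Nat.le_add_right _ _)
      (by rw [← hb, ← hq, map_add]; exact Nat.le_add_right _ _), map_sum]
    refine Finset.sum_congr rfl fun kap _ => ?_
    rw [map_sum]
    refine Finset.sum_congr rfl fun tau _ => ?_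
    refine Eq.trans ?_ (map_smul (MvPowerSeries.coeff (p.1.sumElim q.1)) _ _).symm
    rw [smul_eq_mul, ← coeff_slice p.1 q.1, slice_rename_inl_mul]
    congr 1
  rw [h, Finset.sum_mul, map_sum]
  refine Finset.sum_congr rfl fun kap _ => ?_
  rw [Finset.sum_mul, map_sum]
  refine Finset.sum_congr rfl fun tau _ => ?_
  rw [smul_mul_assoc, map_smul, smul_eq_mul]

/-! ### The Cauchy identity -/

theorem slice_cauchyKernel (m : ℕ →₀ ℕ) : slice m cauchyKernel = hsymmProd m := by
  ext b
  rw [coeff_slice, coeff_cauchyKernel, coeff_hsymmProd_comm]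

/-- The coefficient of `s_λ` in `h_m` is the Kostka number of `λ` and `m`, which is also the
coefficient of `x ^ m` in `s_λ`. -/
theorem schurFunctional_hsymmProd (lam : YoungDiagram) (m : ℕ →₀ ℕ) :
    schurFunctional lam (hsymmProd m) = MvPowerSeries.coeff m (schurSeries lam) := by
  rw [coeff_schurSeries]
  exact congrArg (jtSum _ lam) (funext fun b => coeff_hsymmProd_comm b m)

/-- The Cauchy identity `∏ (1 - x_i y_a)⁻¹ = ∑_μ s_μ(x) s_μ(y)`. -/
theorem partialSchurFunctional_cauchyKernel (mu : YoungDiagram) :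
    partialSchurFunctional mu cauchyKernel = schurSeries mu := by
  ext m
  rw [coeff_partialSchurFunctional, slice_cauchyKernel, schurFunctional_hsymmProd]

theorem isBisymmetric_cauchyKernel : IsBisymmetric cauchyKernel where
  slice_mem m := by rw [slice_cauchyKernel]; exact hsymmProd_mem m
  partial_mem mu := by rw [partialSchurFunctional_cauchyKernel]; exact schurSeries_mem mu

theorem biSchurFunctional_cauchyKernel_mul (lam mu : YoungDiagram) (f g : MvPowerSeries ℕ ℤ) :
    biSchurFunctional lam mu (cauchyKernel *
      (MvPowerSeries.rename (Function.Embedding.inl : ℕ ↪ ℕ ⊕ ℕ) f *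
        MvPowerSeries.rename (Function.Embedding.inr : ℕ ↪ ℕ ⊕ ℕ) g)) =
      ∑ sigma ∈ partitionsLE lam.card,
        schurFunctional lam (schurSeries sigma * f) *
          schurFunctional mu (schurSeries sigma * g) := by
  classical
  rw [isBisymmetric_cauchyKernel.biSchurFunctional_mul]
  refine Finset.sum_congr rfl fun sigma _ => ?_
  have h : ∀ tau, biSchurFunctional sigma tau cauchyKernel * biSchurFunctional lam mu
      (MvPowerSeries.rename (Function.Embedding.inl : ℕ ↪ ℕ ⊕ ℕ) (schurSeries sigma) *
        MvPowerSeries.rename (Function.Embedding.inr : ℕ ↪ ℕ ⊕ ℕ) (schurSeries tau) *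
      (MvPowerSeries.rename (Function.Embedding.inl : ℕ ↪ ℕ ⊕ ℕ) f *
        MvPowerSeries.rename (Function.Embedding.inr : ℕ ↪ ℕ ⊕ ℕ) g)) =
      if sigma = tau then schurFunctional lam (schurSeries sigma * f) *
        schurFunctional mu (schurSeries sigma * g) else 0 := by
    intro tau
    rw [biSchurFunctional_apply, partialSchurFunctional_cauchyKernel, schurFunctional_schurSeries,
      mul_mul_mul_comm, ← map_mul, ← map_mul, biSchurFunctional_rename_inl_mul]
    split_ifs with h
    · rw [h, one_mul]
    · rw [zero_mul]
  simp only [h]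
  rw [Finset.sum_ite_eq]
  split_ifs with hs
  · rfl
  · rw [mem_partitionsLE] at hs
    rw [schurFunctional_schurSeries_mul_eq_zero (lam := mu) (by omega), mul_zero]

/-! ### Splitting the alphabet -/

theorem embDomain_sumCongr (e e' : Equiv.Perm ℕ) (m b : ℕ →₀ ℕ) :
    (m.sumElim b).embDomain (Equiv.sumCongr e e').toEmbedding =
      (m.embDomain e.toEmbedding).sumElim (b.embDomain e'.toEmbedding) := by
  simp only [Finsupp.embDomain_eq_mapDomain, Finsupp.sumElim_eq_add, Finsupp.mapDomain_add,
    ← Finsupp.mapDomain_comp]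
  rfl

theorem embDomain_refl (m : ℕ →₀ ℕ) : m.embDomain (Equiv.refl ℕ).toEmbedding = m := by
  rw [Finsupp.embDomain_eq_mapDomain]
  exact Finsupp.mapDomain_id

theorem isBisymmetric_of_mem {F : MvPowerSeries (ℕ ⊕ ℕ) ℤ} (hF : F ∈ symmetricSeries (ℕ ⊕ ℕ)) :
    IsBisymmetric F := by
  constructor
  · intro m
    refine mem_symmetricSeries_of_coeff fun e b => ?_
    rw [coeff_slice, coeff_slice, ← coeff_embDomain_of_mem hF
      (Equiv.sumCongr (Equiv.refl ℕ) e) (m.sumElim b), embDomain_sumCongr, embDomain_refl]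
  · intro mu
    refine mem_symmetricSeries_of_coeff fun e m => ?_
    rw [coeff_partialSchurFunctional, coeff_partialSchurFunctional]
    congr 1
    ext b
    rw [coeff_slice, coeff_slice, ← coeff_embDomain_of_mem hF
      (Equiv.sumCongr e (Equiv.refl ℕ)) (m.sumElim b), embDomain_sumCongr, embDomain_refl]

theorem rename_mem_symmetricSeries {σ τ : Type*} (e : σ ≃ τ) {f : MvPowerSeries σ ℤ}
    (hf : f ∈ symmetricSeries σ) : MvPowerSeries.rename e f ∈ symmetricSeries τ := by
  intro e'
  have h : (e' ∘ e : σ → τ) = e ∘ (e.symm.permCongr e') := by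
    funext x; simp [Equiv.permCongr_apply]
  conv_rhs => rw [← hf (e.symm.permCongr e')]
  rw [MvPowerSeries.rename_rename, MvPowerSeries.rename_rename]
  congr 2

/-- The exponent vectors `b` and `c` are concatenated along the bijection `e`. -/
theorem hsymmProd_mul (e : ℕ ≃ ℕ ⊕ ℕ) {b c d : ℕ →₀ ℕ}
    (h : d.embDomain e.toEmbedding = b.sumElim c) : hsymmProd b * hsymmProd c = hsymmProd d := by
  have h1 := Finsupp.prod_sumElim b c (fun _ r => hsymmSeries ℕ r)
  rw [← h, Finsupp.prod_embDomain] at h1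
  exact h1.symm

theorem schurSeries_mul_eq_jtSum (kap tau : YoungDiagram) :
    schurSeries kap * schurSeries tau = jtSum (kap.colLen 0) kap fun b =>
      jtSum (tau.colLen 0) tau fun c => hsymmProd b * hsymmProd c := by
  rw [schurSeries_eq_jtSum (lam := kap) le_rfl, schurSeries_eq_jtSum (lam := tau) le_rfl]
  refine (map_jtSum (AddMonoidHom.mulRight (jtSum (tau.colLen 0) tau hsymmProd)) _ _ _).trans
    (congrArg (jtSum _ kap) (funext fun b => ?_))
  exact map_jtSum (AddMonoidHom.mulLeft (hsymmProd b)) _ _ _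

theorem map_schurSeries_mul (L : MvPowerSeries ℕ ℤ →+ ℤ) (kap tau : YoungDiagram) :
    L (schurSeries kap * schurSeries tau) = jtSum (kap.colLen 0) kap fun b =>
      jtSum (tau.colLen 0) tau fun c => L (hsymmProd b * hsymmProd c) := by
  rw [schurSeries_mul_eq_jtSum, map_jtSum]
  refine congrArg (jtSum _ kap) (funext fun b => ?_)
  rw [map_jtSum]

theorem biSchurFunctional_eq_jtSum (kap tau : YoungDiagram) (F : MvPowerSeries (ℕ ⊕ ℕ) ℤ) :
    biSchurFunctional kap tau F = jtSum (kap.colLen 0) kap fun b =>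
      jtSum (tau.colLen 0) tau fun c => MvPowerSeries.coeff (b.sumElim c) F := rfl

/-- For a symmetric `f`, the coefficient of `s_κ(x) s_τ(y)` in `f(x, y)`, where the combined
alphabet is enumerated by `e`, is `∑_ν c_{κτ}^ν a_ν` with `a_ν` the coefficient of `s_ν` in `f`. By
Jacobi–Trudi both `s_κ s_τ` and the functional expand over products of complete functions; the
functional `s_ν ↦ a_ν` sends `h_d` to the coefficient of `x ^ d` in `f`. -/
theorem biSchurFunctional_rename (e : ℕ ≃ ℕ ⊕ ℕ) {f : MvPowerSeries ℕ ℤ}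
    (hf : f ∈ symmetricSeries ℕ) (kap tau : YoungDiagram) :
    biSchurFunctional kap tau (MvPowerSeries.rename e f) =
      ∑ nu ∈ partitionsLE (kap.card + tau.card),
        schurFunctional nu (schurSeries kap * schurSeries tau) * schurFunctional nu f := by
  obtain ⟨L, hL⟩ : ∃ L : MvPowerSeries ℕ ℤ →+ ℤ, ∀ g, L g =
      ∑ nu ∈ partitionsLE (kap.card + tau.card), schurFunctional nu g * schurFunctional nu f :=
    ⟨⟨⟨fun g => ∑ nu ∈ partitionsLE (kap.card + tau.card),
        schurFunctional nu g * schurFunctional nu f, by simp⟩,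
      fun g g' => by simp only [map_add, add_mul, Finset.sum_add_distrib]⟩, fun _ => rfl⟩
  have hLh : ∀ d : ℕ →₀ ℕ, d.degree ≤ kap.card + tau.card →
      L (hsymmProd d) = MvPowerSeries.coeff d f := by
    intro d hd
    rw [hL, coeff_eq_sum_schurFunctional hf hd]
    refine Finset.sum_congr rfl fun nu _ => ?_
    rw [schurFunctional_hsymmProd, mul_comm]
  rw [← hL, map_schurSeries_mul, biSchurFunctional_eq_jtSum]
  refine jtSum_congr le_rfl fun b hb => jtSum_congr le_rfl fun c hc => ?_
  obtain ⟨d, hd⟩ := exists_embDomain_equiv e (b.sumElim c)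
  have hdeg : d.degree = kap.card + tau.card := by
    rw [← hb, ← hc, ← degree_embDomain e.toEmbedding d, hd, Finsupp.sumElim_eq_add, map_add]
    simp
  rw [hsymmProd_mul e hd, hLh d hdeg.le, ← hd, coeff_embDomain_equiv]

/-! ### Characters defined by a generating function -/

theorem coeff_inX_mul_inY (X Y : symmetricFunctions) (m b : ℕ →₀ ℕ) :
    MvPowerSeries.coeff (m.sumElim b) (inX X * inY Y) =
      MvPowerSeries.coeff m (X : MvPowerSeries ℕ ℤ) *
        MvPowerSeries.coeff b (Y : MvPowerSeries ℕ ℤ) := by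
  rw [← coeff_slice, inX, inY, slice_rename_inl_mul]
  exact map_smul (MvPowerSeries.coeff b) _ _

/-- A generating function `K(x, y) p(y) = ∑_λ o_λ(x) s_λ(y)` determines its coefficients: the
coefficient of `x ^ m` in `o_λ` is that of `s_λ` in `h_m p`. -/
theorem hasSum_cauchyKernel_mul_iff {p : MvPowerSeries ℕ ℤ} (hp : p ∈ symmetricSeries ℕ)
    (o : YoungDiagram → symmetricFunctions) :
    HasSum (fun lam => inX (o lam) * inY (schur lam))
      (cauchyKernel * MvPowerSeries.rename (Function.Embedding.inr : ℕ ↪ ℕ ⊕ ℕ) p) ↔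
      ∀ lam m, MvPowerSeries.coeff m (o lam : MvPowerSeries ℕ ℤ) =
        schurFunctional lam (hsymmProd m * p) := by
  have key : HasSum (fun lam => inX (o lam) * inY (schur lam))
      (cauchyKernel * MvPowerSeries.rename (Function.Embedding.inr : ℕ ↪ ℕ ⊕ ℕ) p) ↔
      ∀ m b : ℕ →₀ ℕ, MvPowerSeries.coeff b (hsymmProd m * p) =
        MvPowerSeries.coeff b
          (schurSum fun lam => MvPowerSeries.coeff m (o lam : MvPowerSeries ℕ ℤ)) := by
    rw [MvPowerSeries.WithPiTopology.hasSum_iff_hasSum_coeff]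
    have h : ∀ m b : ℕ →₀ ℕ, HasSum
        (fun lam => MvPowerSeries.coeff (m.sumElim b) (inX (o lam) * inY (schur lam)))
        (MvPowerSeries.coeff b
          (schurSum fun lam => MvPowerSeries.coeff m (o lam : MvPowerSeries ℕ ℤ))) := by
      intro m b
      simp only [coeff_inX_mul_inY]
      rw [coeff_schurSum _ le_rfl]
      refine hasSum_sum_of_ne_finset_zero fun lam hlam => ?_
      rw [mem_partitionsLE] at hlam
      have : MvPowerSeries.coeff b (schur lam : MvPowerSeries ℕ ℤ) = 0 :=
        isHomogeneousSeries_schurSeries lam b (by omega)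
      rw [this, mul_zero]
    constructor
    · intro H m b
      rw [← (H (m.sumElim b)).unique (h m b), ← coeff_slice, slice_mul_rename_inr,
        slice_cauchyKernel]
    · intro H d
      obtain ⟨m, b, rfl⟩ := exists_sumElim d
      rw [← coeff_slice m b (_ * _), slice_mul_rename_inr, slice_cauchyKernel, H m b]
      exact h m b
  rw [key]
  constructor
  · intro H lam m
    rw [MvPowerSeries.ext (H m), schurFunctional_schurSum]
  · intro H m b
    simp only [H]
    rw [schurSum_schurFunctional (mul_mem (hsymmProd_mem m) hp)]

/-- The family with generating function `K(x, y) p(y)`, where `K` is the Cauchy kernel. The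
coefficient of `s_κ` in its `λ`-th member is that of `s_λ` in `s_κ p`, so that
`s_λ ↦ universalCharacter p λ` is adjoint to multiplication by `p`. -/
noncomputable def universalCharacter (p : MvPowerSeries ℕ ℤ) (lam : YoungDiagram) :
    symmetricFunctions :=
  ∑ kap ∈ partitionsLE lam.card, schurFunctional lam (schurSeries kap * p) • schur kap

theorem coe_sum_schur (c : YoungDiagram → ℤ) (s : Finset YoungDiagram) :
    ((∑ kap ∈ s, c kap • schur kap : symmetricFunctions) : MvPowerSeries ℕ ℤ) =
      ∑ kap ∈ s, c kap • schurSeries kap := by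
  simp [schur]

theorem coeff_universalCharacter (p : MvPowerSeries ℕ ℤ) (lam : YoungDiagram) (m : ℕ →₀ ℕ) :
    MvPowerSeries.coeff m (universalCharacter p lam : MvPowerSeries ℕ ℤ) =
      schurFunctional lam (hsymmProd m * p) := by
  rw [universalCharacter, coe_sum_schur, schurFunctional_mul (hsymmProd_mem m), map_sum]
  refine Finset.sum_congr rfl fun kap _ => (map_smul (MvPowerSeries.coeff m) _ _).trans ?_
  rw [schurFunctional_hsymmProd, smul_eq_mul, mul_comm]

theorem hasSum_cauchyKernel_mul_iff_eq {p : MvPowerSeries ℕ ℤ} (hp : p ∈ symmetricSeries ℕ)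
    (o : YoungDiagram → symmetricFunctions) :
    HasSum (fun lam => inX (o lam) * inY (schur lam))
      (cauchyKernel * MvPowerSeries.rename (Function.Embedding.inr : ℕ ↪ ℕ ⊕ ℕ) p) ↔
      o = universalCharacter p := by
  rw [hasSum_cauchyKernel_mul_iff hp]
  simp only [← coeff_universalCharacter]
  refine ⟨fun h => funext fun lam => Subtype.ext (MvPowerSeries.ext (h lam)), ?_⟩
  rintro rfl lam m
  rfl

/-- The coefficients of `universalCharacter p lam` without the restriction to `|θ| ≤ |λ|`. -/
theorem schurFunctional_universalCharacter (p : MvPowerSeries ℕ ℤ) (lam theta : YoungDiagram) :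
    schurFunctional theta (universalCharacter p lam) =
      schurFunctional lam (schurSeries theta * p) := by
  classical
  rw [universalCharacter, coe_sum_schur,
    schurFunctional_sum_schurSeries fun kap => schurFunctional lam (schurSeries kap * p)]
  split_ifs with h
  · rfl
  · rw [mem_partitionsLE] at h
    rw [schurFunctional_schurSeries_mul_eq_zero (by omega)]

/-! ### Skew Schur functions and linear extensions -/

theorem lrCoeff_eq (lam mu nu : YoungDiagram) :
    lrCoeff lam mu nu = schurFunctional nu (schurSeries lam * schurSeries mu) :=
  schurCoeff_apply _ _

theorem lrCoeff_eq_zero_left {lam mu nu : YoungDiagram} (h : nu.card < lam.card) :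
    lrCoeff lam mu nu = 0 := by
  rw [lrCoeff_eq, schurFunctional_schurSeries_mul_eq_zero h]

theorem lrCoeff_eq_zero_right {lam mu nu : YoungDiagram} (h : nu.card < mu.card) :
    lrCoeff lam mu nu = 0 := by
  rw [lrCoeff_eq, mul_comm, schurFunctional_schurSeries_mul_eq_zero h]

theorem skewSchur_eq_sum (nu lam : YoungDiagram) :
    skewSchur nu lam = ∑ mu ∈ partitionsLE nu.card, lrCoeff lam mu nu • schur mu := by
  refine finsum_eq_sum_of_support_subset _ fun mu hmu => ?_
  rw [Finset.mem_coe, mem_partitionsLE]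
  by_contra h
  refine hmu ?_
  change lrCoeff lam mu nu • schur mu = 0
  rw [lrCoeff_eq_zero_right (by omega)]
  exact zero_smul ℤ (schur mu)

theorem skewSchur_eq_zero {nu lam : YoungDiagram} (h : nu.card < lam.card) :
    skewSchur nu lam = 0 := by
  rw [skewSchur_eq_sum]
  refine Finset.sum_eq_zero fun mu _ => ?_
  rw [lrCoeff_eq_zero_left h]
  exact zero_smul ℤ (schur mu)

theorem linearExtension_add (ch : YoungDiagram → symmetricFunctions) (X Y : symmetricFunctions) :
    linearExtension ch (X + Y) = linearExtension ch X + linearExtension ch Y := by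
  have h : schurCoeff (X + Y) = schurCoeff X + schurCoeff Y := by
    ext lam
    rw [Finsupp.add_apply, schurCoeff_apply, schurCoeff_apply, schurCoeff_apply, ← map_add]
    rfl
  rw [linearExtension, h, map_add]
  rfl

/-- `linearExtension ch` as an additive map. -/
noncomputable def linearExtensionHom (ch : YoungDiagram → symmetricFunctions) :
    symmetricFunctions →+ symmetricFunctions :=
  AddMonoidHom.mk' (linearExtension ch) (linearExtension_add ch)

theorem linearExtensionHom_apply (ch : YoungDiagram → symmetricFunctions) (X : symmetricFunctions) :
    linearExtensionHom ch X = linearExtension ch X := rfl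

theorem coe_linearExtension (ch : YoungDiagram → symmetricFunctions) {X : symmetricFunctions}
    {s : Finset YoungDiagram} (hs : ∀ nu ∉ s, schurFunctional nu X = 0) :
    linearExtension ch X = ∑ nu ∈ s, schurFunctional nu X • ch nu := by
  rw [linearExtension, Finsupp.linearCombination_apply,
    Finsupp.sum_of_support_subset (s := s) _ _ _ fun nu _ => zero_smul ℤ (ch nu)]
  · simp only [schurCoeff_apply]
  · intro nu hnu
    by_contra h
    rw [Finsupp.mem_support_iff, schurCoeff_apply, hs nu h] at hnu
    exact hnu rfl

theorem schurFunctional_coe_sum {ι : Type*} (theta : YoungDiagram) (s : Finset ι) (c : ι → ℤ)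
    (X : ι → symmetricFunctions) :
    schurFunctional theta (∑ i ∈ s, c i • X i : symmetricFunctions) =
      ∑ i ∈ s, c i * schurFunctional theta (X i) := by
  rw [AddSubmonoidClass.coe_finsetSum, map_sum]
  exact Finset.sum_congr rfl fun i _ => map_smul (schurFunctional theta) (c i) _

/-- By adjointness, the coefficient of `s_θ` in the linear extension at `s_κ s_τ` is that of
`s_κ(x) s_τ(y)` in `(s_θ p)(x, y)`. -/
theorem schurFunctional_linearExtension_mul (e : ℕ ≃ ℕ ⊕ ℕ) {p : MvPowerSeries ℕ ℤ}
    (hp : p ∈ symmetricSeries ℕ) (kap tau theta : YoungDiagram) :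
    schurFunctional theta (linearExtension (universalCharacter p) (schur kap * schur tau)) =
      biSchurFunctional kap tau (MvPowerSeries.rename e (schurSeries theta * p)) := by
  have h : ∀ nu ∉ partitionsLE (kap.card + tau.card),
      schurFunctional nu (schur kap * schur tau : symmetricFunctions) = 0 := by
    intro nu hnu
    rw [mem_partitionsLE] at hnu
    exact schurFunctional_eq_zero
      ((isHomogeneousSeries_schurSeries kap).mul (isHomogeneousSeries_schurSeries tau)) (by omega)
  rw [coe_linearExtension _ h, schurFunctional_coe_sum,
    biSchurFunctional_rename e (mul_mem (schurSeries_mem theta) hp)]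
  refine Finset.sum_congr rfl fun nu _ => ?_
  rw [schurFunctional_universalCharacter]
  rfl

/-! ### The product formula -/

theorem linearExtension_skewSchur_mul (ch : YoungDiagram → symmetricFunctions)
    (lam mu sigma : YoungDiagram) :
    linearExtension ch (skewSchur lam sigma * skewSchur mu sigma) =
      ∑ kap ∈ partitionsLE lam.card, ∑ tau ∈ partitionsLE mu.card,
        (lrCoeff sigma kap lam * lrCoeff sigma tau mu) •
          linearExtension ch (schur kap * schur tau) := by
  rw [skewSchur_eq_sum, skewSchur_eq_sum, Finset.sum_mul_sum, ← linearExtensionHom_apply, map_sum]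
  refine Finset.sum_congr rfl fun kap _ => ?_
  rw [map_sum]
  refine Finset.sum_congr rfl fun tau _ => ?_
  rw [smul_mul_smul_comm, map_zsmul]
  rfl

theorem linearExtension_skewSchur_mul_eq_zero (ch : YoungDiagram → symmetricFunctions)
    {lam mu sigma : YoungDiagram} (h : lam.card < sigma.card) :
    linearExtension ch (skewSchur lam sigma * skewSchur mu sigma) = 0 := by
  rw [skewSchur_eq_zero h, zero_mul, ← linearExtensionHom_apply, map_zero]

/-- The sum over `σ` of skew Schur functions amounts to multiplication by the Cauchy kernel. -/
theorem schurFunctional_sum_linearExtension (e : ℕ ≃ ℕ ⊕ ℕ) {p : MvPowerSeries ℕ ℤ}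
    (hp : p ∈ symmetricSeries ℕ) (lam mu theta : YoungDiagram) :
    schurFunctional theta (∑ sigma ∈ partitionsLE lam.card, linearExtension (universalCharacter p)
        (skewSchur lam sigma * skewSchur mu sigma) : symmetricFunctions) =
      biSchurFunctional lam mu
        (MvPowerSeries.rename e (schurSeries theta * p) * cauchyKernel) := by
  have hF : IsBisymmetric (MvPowerSeries.rename e (schurSeries theta * p)) :=
    isBisymmetric_of_mem (rename_mem_symmetricSeries e (mul_mem (schurSeries_mem theta) hp))
  have h1 : ∀ sigma, schurFunctional theta (linearExtension (universalCharacter p)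
        (skewSchur lam sigma * skewSchur mu sigma)) =
      ∑ kap ∈ partitionsLE lam.card, ∑ tau ∈ partitionsLE mu.card,
        lrCoeff sigma kap lam * lrCoeff sigma tau mu *
          biSchurFunctional kap tau (MvPowerSeries.rename e (schurSeries theta * p)) := by
    intro sigma
    rw [linearExtension_skewSchur_mul, ← Finset.sum_product', ← Finset.sum_product',
      schurFunctional_coe_sum]
    simp only [schurFunctional_linearExtension_mul e hp]
  have h2 : ∀ s : Finset YoungDiagram, ∀ Y : YoungDiagram → symmetricFunctions,
      schurFunctional theta (∑ i ∈ s, Y i : symmetricFunctions) =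
        ∑ i ∈ s, schurFunctional theta (Y i) := fun s Y => by simp
  rw [h2, hF.biSchurFunctional_mul]
  simp only [h1]
  rw [Finset.sum_comm]
  refine Finset.sum_congr rfl fun kap _ => ?_
  rw [Finset.sum_comm]
  refine Finset.sum_congr rfl fun tau _ => ?_
  rw [mul_comm _ cauchyKernel, biSchurFunctional_cauchyKernel_mul, ← Finset.sum_mul, mul_comm]
  simp only [lrCoeff_eq]

/-- The coefficient of `s_θ` in a product is a coefficient of `s_θ(x, y) p(x) p(y)`. -/
theorem schurFunctional_universalCharacter_mul (e : ℕ ≃ ℕ ⊕ ℕ) {p : MvPowerSeries ℕ ℤ}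
    (lam mu theta : YoungDiagram) :
    schurFunctional theta
        (universalCharacter p lam * universalCharacter p mu : symmetricFunctions) =
      biSchurFunctional lam mu (MvPowerSeries.rename e (schurSeries theta) *
        (MvPowerSeries.rename (Function.Embedding.inl : ℕ ↪ ℕ ⊕ ℕ) p *
          MvPowerSeries.rename (Function.Embedding.inr : ℕ ↪ ℕ ⊕ ℕ) p)) := by
  classical
  have hF : IsBisymmetric (MvPowerSeries.rename e (schurSeries theta)) :=
    isBisymmetric_of_mem (rename_mem_symmetricSeries e (schurSeries_mem theta))
  have hcoeff : ∀ kap tau, biSchurFunctional kap tau (MvPowerSeries.rename e (schurSeries theta)) =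
      schurFunctional theta (schurSeries kap * schurSeries tau) := by
    intro kap tau
    rw [biSchurFunctional_rename e (schurSeries_mem theta)]
    simp only [schurFunctional_schurSeries, mul_ite, mul_one, mul_zero]
    rw [Finset.sum_ite_eq']
    split_ifs with h
    · rfl
    · rw [mem_partitionsLE] at h
      exact (schurFunctional_eq_zero ((isHomogeneousSeries_schurSeries kap).mul
        (isHomogeneousSeries_schurSeries tau)) (by omega)).symm
  rw [hF.biSchurFunctional_mul, universalCharacter, universalCharacter, Finset.sum_mul_sum,
    ← Finset.sum_product', ← Finset.sum_product']
  simp only [smul_mul_smul_comm]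
  rw [schurFunctional_coe_sum]
  refine Finset.sum_congr rfl fun q _ => ?_
  rw [hcoeff, mul_mul_mul_comm, ← map_mul, ← map_mul, biSchurFunctional_rename_inl_mul, mul_comm]
  rfl

/-- The product formula holds for every symmetric series `p` such that
`p(x, y) ∏ (1 - x_i y_a)⁻¹ = p(x) p(y)`. -/
theorem universalCharacter_mul (e : ℕ ≃ ℕ ⊕ ℕ) {p : MvPowerSeries ℕ ℤ} (hp : p ∈ symmetricSeries ℕ)
    (hK : MvPowerSeries.rename e p * cauchyKernel =
      MvPowerSeries.rename (Function.Embedding.inl : ℕ ↪ ℕ ⊕ ℕ) p *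
        MvPowerSeries.rename (Function.Embedding.inr : ℕ ↪ ℕ ⊕ ℕ) p)
    (lam mu : YoungDiagram) : universalCharacter p lam * universalCharacter p mu =
      ∑ sigma ∈ partitionsLE lam.card, linearExtension (universalCharacter p)
        (skewSchur lam sigma * skewSchur mu sigma) :=
  symmetricFunctions_ext fun theta => by
    rw [schurFunctional_universalCharacter_mul e, schurFunctional_sum_linearExtension e hp,
      map_mul (MvPowerSeries.rename e), mul_assoc, hK]

/-- The orthogonal and symplectic cases are `ε = 1` and `ε = 0`. -/
theorem existsUnique_and_mul_eq_finsum (ε : ℤ) (P : (YoungDiagram → symmetricFunctions) → Prop)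
    (hP : ∀ o, P o ↔ HasSum (fun lam => inX (o lam) * inY (schur lam)) (cauchyKernel *
      MvPowerSeries.rename (Function.Embedding.inr : ℕ ↪ ℕ ⊕ ℕ) (pairProduct ℕ ε))) :
    (∃! o, P o) ∧ ∀ o, P o → ∀ lam mu : YoungDiagram,
      (Function.support fun sigma : YoungDiagram =>
        linearExtension o (skewSchur lam sigma * skewSchur mu sigma)).Finite ∧
      o lam * o mu = ∑ᶠ sigma : YoungDiagram,
        linearExtension o (skewSchur lam sigma * skewSchur mu sigma) := by
  simp only [hP, hasSum_cauchyKernel_mul_iff_eq (pairProduct_mem ℕ ε)]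
  refine ⟨⟨_, rfl, fun _ h => h⟩, ?_⟩
  rintro o rfl lam mu
  have hsupp : (Function.support fun sigma : YoungDiagram =>
      linearExtension (universalCharacter (pairProduct ℕ ε))
        (skewSchur lam sigma * skewSchur mu sigma)) ⊆ ↑(partitionsLE lam.card) := by
    intro sigma hs
    rw [Finset.mem_coe, mem_partitionsLE]
    by_contra h
    exact hs (linearExtension_skewSchur_mul_eq_zero _ (by omega))
  refine ⟨(Finset.finite_toSet _).subset hsupp, ?_⟩
  rw [finsum_eq_sum_of_support_subset _ hsupp]
  refine universalCharacter_mul Equiv.natSumNatEquivNat.symm (pairProduct_mem ℕ ε) ?_ lam mu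
  rw [rename_equiv_pairProduct, pairProduct_sum_mul_cauchyKernel]

theorem theorem4 :
    (∃! o : YoungDiagram → symmetricFunctions, IsOrthogonalCharacters o) ∧
    (∃! sp : YoungDiagram → symmetricFunctions, IsSymplecticCharacters sp) ∧
    (∀ o : YoungDiagram → symmetricFunctions, IsOrthogonalCharacters o →
      ∀ lam mu : YoungDiagram,
        (Function.support fun sigma : YoungDiagram =>
          linearExtension o (skewSchur lam sigma * skewSchur mu sigma)).Finite ∧
        o lam * o mu = ∑ᶠ sigma : YoungDiagram,
          linearExtension o (skewSchur lam sigma * skewSchur mu sigma)) ∧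
    (∀ sp : YoungDiagram → symmetricFunctions, IsSymplecticCharacters sp →
      ∀ lam mu : YoungDiagram,
        (Function.support fun sigma : YoungDiagram =>
          linearExtension sp (skewSchur lam sigma * skewSchur mu sigma)).Finite ∧
        sp lam * sp mu = ∑ᶠ sigma : YoungDiagram,
          linearExtension sp (skewSchur lam sigma * skewSchur mu sigma)) := by
  obtain ⟨ho, ho'⟩ := existsUnique_and_mul_eq_finsum 1 IsOrthogonalCharacters fun o => by
    rw [IsOrthogonalCharacters, productLE_eq]
  obtain ⟨hs, hs'⟩ := existsUnique_and_mul_eq_finsum 0 IsSymplecticCharacters fun o => by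
    rw [IsSymplecticCharacters, productLT_eq]
  exact ⟨ho, hs, ho', hs'⟩
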